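/- **Conventions.** A lattice in a locally compact group $G$ is a discrete subgroup $\Gamma$ such that $G/\Gamma$ carries a non-zero finite $G$-invariant regular Borel measure. A subgroup $H$ of a group $K$ is essential in $K$ if $H$ intersects non-trivially every non-trivial subgroup of $K$. *The groups $L(D,D')$.* Let $X$ be a finite set with $|X| \geq 2$ and $D \leq D' \leq \mathrm{Sym}(X)$. For $m \ge 0$ let $L_m = \cdots \wr D \wr D \wr D' \wr \cdots \wr D'$, with $D'$ appearing $m$ times, be the infinitely iterated permutational wreath product (the projective limit of the finite iterated wreath products in their imprimitive actions on the sets $X^n$). Then $L(D,D') = \bigcup_m L_m$, endowed with the group topology for which the inclusion of the profinite group $L_0$ is continuous and open. *The groups $G(F,F')$.* Let $\Omega$ be a finite set of cardinality $d \geq 3$ and $T$ a $d$-regular tree, with a colouring $c$ of its non-oriented edges by $\Omega$ that restricts, for every vertex $v$, to a bijection $c_v$ from the set of edges containing $v$ onto $\Omega$. The local permutation of $g \in \mathrm{Aut}(T)$ at $v$ is $\sigma(g,v) = c_{gv} \circ g_v \circ c_v^{-1} \in \mathrm{Sym}(\Omega)$, where $g_v$ is the map induced by $g$ from the edges containing $v$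 to the edges containing $gv$. For $F \leq F' \leq \mathrm{Sym}(\Omega)$, $U(F)$ is the group of $g \in \mathrm{Aut}(T)$ with $\sigma(g,v) \in F$ for all vertices $v$, and $G(F,F')$ is the group of $g \in \mathrm{Aut}(T)$ with $\sigma(g,v) \in F'$ for all $v$ and $\sigma(g,v) \in F$ for all but finitely many $v$. It is endowed with the group topology for which the inclusion of $U(F)$ is continuous and open, where $U(F)$ carries the topology of pointwise convergence on the vertices. $F_a$ denotes the stabilizer of $a \in \Omega$ in $F$. **Theorem.** 1. Let $X$ be a finite set of cardinality $\ell \geq 2$ and $D \leq D' \leq \mathrm{Sym}(X)$. If $D$ is essential in $D'$ and $|D'| < (D':D)^{\ell}$, then for every $k \geq 1$ the group $L(D,D')^k$ has no lattice. 2. Let $F \leq F' \leq \mathrm{Sym}(\Omega)$, with $F$ transitive on $\Omega$, let $a \in \Omega$ and $d = |\Omega| \geq 3$. If there is a subgroup $D'$ with $F_a \leq D' \leq F'_a$ such that $F_a$ is essential in $D'$ and $|D'| < (D':F_a)^{d-1}$, then $G(F,F')$ has no lattice. 3. Let $q \equiv 1 \pmod 4$ be a prime power. If $F = \mathrm{PSL}(2,q)$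 and $F' = \mathrm{PGL}(2,q)$, acting on the projective line $\Omega = \mathbb{P}^1(\mathbb{F}_q)$, then $G(F,F')$ has no lattice. 4. In particular, there exist a finite set $\Omega$ with $|\Omega| \geq 3$ and permutation groups $F \leq F' \leq \mathrm{Sym}(\Omega)$, with $F'$ preserving each orbit of $F$, such that $G(F,F')$ has no lattice. -/

import Mathlib

open MeasureTheory
open scoped LinearAlgebra.Projectivization

namespace TreeLattice

universe u v

/-! ## Lattices and essential subgroups -/

section Lattices

variable {G : Type u} [Group G]

/-- A lattice in a topological group `G`: a discrete subgroup `Γ` such that `G ⧸ Γ` carries a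
non-zero finite `G`-invariant regular Borel measure. -/
def IsLatticeIn [TopologicalSpace G] (Γ : Subgroup G) : Prop :=
  DiscreteTopology Γ ∧
    ∃ (_ : MeasurableSpace (G ⧸ Γ)) (_ : BorelSpace (G ⧸ Γ)) (μ : Measure (G ⧸ Γ)),
      IsFiniteMeasure μ ∧ μ ≠ 0 ∧ μ.Regular ∧ SMulInvariantMeasure G (G ⧸ Γ) μ

/-- The topological group `G` contains a lattice. -/
def HasLattice (G : Type u) [Group G] [TopologicalSpace G] : Prop :=
  ∃ Γ : Subgroup G, IsLatticeIn Γ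

/-- `H` is an essential subgroup of `K`: it is contained in `K` and intersects non-trivially
every non-trivial subgroup of `K`. -/
def IsEssentialIn (H K : Subgroup G) : Prop :=
  H ≤ K ∧ ∀ S : Subgroup G, S ≤ K → S ≠ ⊥ → H ⊓ S ≠ ⊥

/-- The group filter basis made of a filtered family of subgroups that is stable, up to
refinement, under conjugation. It defines the group topology for which the members of the family
form a basis of neighbourhoods of the identity. -/
@[reducible] def basisOfSubgroups {ι : Type v} [Nonempty ι] (B : ι → Subgroup G)
    (inter : ∀ i j, ∃ k, B k ≤ B i ⊓ B j)
    (conj : ∀ (g : G) (i : ι), ∃ j, ∀ u ∈ B j, g * u * g⁻¹ ∈ B i) : GroupFilterBasis G where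
  sets := Set.range fun i => (B i : Set G)
  nonempty := Set.range_nonempty _
  inter_sets := by
    rintro _ _ ⟨i, rfl⟩ ⟨j, rfl⟩
    obtain ⟨k, hk⟩ := inter i j
    exact ⟨_, ⟨k, rfl⟩, hk⟩
  one' := by
    rintro _ ⟨i, rfl⟩
    exact (B i).one_mem
  mul' := by
    rintro _ ⟨i, rfl⟩
    refine ⟨_, ⟨i, rfl⟩, ?_⟩
    rintro _ ⟨x, hx, y, hy, rfl⟩
    exact (B i).mul_mem hx hy
  inv' := by
    rintro _ ⟨i, rfl⟩
    exact ⟨_, ⟨i, rfl⟩, fun x hx => (B i).inv_mem hx⟩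
  conj' := by
    rintro g _ ⟨i, rfl⟩
    obtain ⟨j, hj⟩ := conj g i
    exact ⟨_, ⟨j, rfl⟩, hj⟩

theorem nhds_basisOfSubgroups {ι : Type v} [Nonempty ι] (B : ι → Subgroup G)
    (inter : ∀ i j, ∃ k, B k ≤ B i ⊓ B j)
    (conj : ∀ (g : G) (i : ι), ∃ j, ∀ u ∈ B j, g * u * g⁻¹ ∈ B i) (g : G) :
    (@nhds G (basisOfSubgroups B inter conj).topology g).HasBasis (fun _ : ι => True)
      (fun i => {x | g⁻¹ * x ∈ B i}) := by
  refine ((basisOfSubgroups B inter conj).nhds_hasBasis g).to_hasBasis ?_ ?_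
  · rintro _ ⟨i, rfl⟩
    refine ⟨i, trivial, fun x hx => ⟨g⁻¹ * x, hx, by simp⟩⟩
  · rintro i -
    refine ⟨_, ⟨i, rfl⟩, ?_⟩
    rintro _ ⟨x, hx, rfl⟩
    simpa using hx

end Lattices

/-! ## The groups `G(F, F')` -/

/-- The stabilizer `F_a` of the point `a` in the permutation group `F`. -/
def pointStab {Ω : Type u} (F : Subgroup (Equiv.Perm Ω)) (a : Ω) : Subgroup (Equiv.Perm Ω) :=
  F ⊓ MulAction.stabilizer (Equiv.Perm Ω) a

section Tree

variable {V : Type v} {Ω : Type u} {T : SimpleGraph V}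

/-- A colouring of the (non-oriented) edges of `T` by `Ω` which restricts, for every vertex `v`,
to a bijection from the set of edges containing `v` (the edges from `v` to its neighbours)
onto `Ω`. -/
structure LegalColoring (T : SimpleGraph V) (Ω : Type u) where
  /-- the colour of an edge -/
  color : T.edgeSet → Ω
  /-- all colours appear exactly once around every vertex -/
  bijective : ∀ v : V, Function.Bijective fun w : T.neighborSet v => color ⟨s(v, w.1), w.2⟩

namespace LegalColoring

variable (c : LegalColoring T Ω)

/-- The bijection `c_v` from the set of edges around `v` (indexed by the neighbours of `v`)
to `Ω`. -/
noncomputable def equivAt (v : V) : T.neighborSet v ≃ Ω :=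
  Equiv.ofBijective _ (c.bijective v)

/-- The local permutation `σ(g, v) = c_{gv} ∘ g_v ∘ c_v⁻¹` of `g ∈ Aut(T)` at the vertex `v`. -/
noncomputable def localPerm (g : T ≃g T) (v : V) : Equiv.Perm Ω :=
  ((c.equivAt v).symm.trans (g.mapNeighborSet v)).trans (c.equivAt (g v))

theorem localPerm_equivAt (g : T ≃g T) (v : V) (w : T.neighborSet v) :
    c.localPerm g v (c.equivAt v w) = c.equivAt (g v) (g.mapNeighborSet v w) := by
  simp [localPerm]

theorem localPerm_one (v : V) : c.localPerm 1 v = 1 := by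
  ext a
  obtain ⟨w, rfl⟩ := (c.equivAt v).surjective a
  rw [localPerm_equivAt]
  rfl

theorem localPerm_mul (g h : T ≃g T) (v : V) :
    c.localPerm (g * h) v = c.localPerm g (h v) * c.localPerm h v := by
  ext a
  obtain ⟨w, rfl⟩ := (c.equivAt v).surjective a
  rw [Equiv.Perm.mul_apply, localPerm_equivAt, localPerm_equivAt, localPerm_equivAt]
  rfl

theorem localPerm_inv (g : T ≃g T) (v : V) :
    c.localPerm g⁻¹ v = (c.localPerm g (g⁻¹ v))⁻¹ := by
  have h := c.localPerm_mul g g⁻¹ v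
  rw [mul_inv_cancel, localPerm_one] at h
  exact (inv_eq_of_mul_eq_one_right h.symm).symm

/-- If `u` fixes `v` and all its neighbours, then its local permutation at `v` is trivial. -/
theorem localPerm_eq_one {u : T ≃g T} {v : V} (hv : u v = v) (hn : ∀ w, T.Adj v w → u w = w) :
    c.localPerm u v = 1 := by
  ext a
  obtain ⟨w, rfl⟩ := (c.equivAt v).surjective a
  rw [localPerm_equivAt]
  change c.color _ = c.color _
  congr 2
  change s(u v, u w.1) = s(v, w.1)
  rw [hv, hn _ w.2]

/-- The Burger-Mozes group `U(F)`: all local permutations are in `F`. -/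
def burgerMozes (F : Subgroup (Equiv.Perm Ω)) : Subgroup (T ≃g T) where
  carrier := {g | ∀ v, c.localPerm g v ∈ F}
  one_mem' v := by rw [localPerm_one]; exact F.one_mem
  mul_mem' hg hh v := by rw [localPerm_mul]; exact F.mul_mem (hg _) (hh _)
  inv_mem' hg v := by rw [localPerm_inv]; exact F.inv_mem (hg _)

/-- The set `S(g)` of singularities of `g` with respect to `F`. -/
def singularities (F : Subgroup (Equiv.Perm Ω)) (g : T ≃g T) : Set V :=
  {v | c.localPerm g v ∉ F}

/-- The group `G(F)`: all but finitely many local permutations are in `F`. -/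
def almostPrescribed (F : Subgroup (Equiv.Perm Ω)) : Subgroup (T ≃g T) where
  carrier := {g | (c.singularities F g).Finite}
  one_mem' := by
    convert Set.finite_empty (α := V)
    simp [singularities, localPerm_one, F.one_mem]
  mul_mem' {g h} hg hh := by
    refine (hh.union (hg.preimage (h.injective.injOn))).subset fun v hv => ?_
    by_contra hcon
    simp only [singularities, Set.mem_union, Set.mem_preimage, Set.mem_ofPred_eq, not_or,
      not_not] at hcon
    exact hv (by rw [localPerm_mul]; exact F.mul_mem hcon.2 hcon.1)
  inv_mem' {g} hg := by
    refine (hg.preimage ((g⁻¹ : T ≃g T).injective.injOn)).subset fun v hv hcon => hv ?_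
    rw [localPerm_inv]
    exact F.inv_mem hcon

/-- The group `G(F, F') = G(F) ∩ U(F')`, as a subgroup of `Aut(T)`. -/
def prescribed (F F' : Subgroup (Equiv.Perm Ω)) : Subgroup (T ≃g T) :=
  c.almostPrescribed F ⊓ c.burgerMozes F'

/-- The group `G(F, F')`, as a group of its own. It gets its own topology below, which is not
the one induced from `Aut(T)`. -/
def GroupG (F F' : Subgroup (Equiv.Perm Ω)) : Type v := ↥(c.prescribed F F')

noncomputable instance (F F' : Subgroup (Equiv.Perm Ω)) : Group (c.GroupG F F') :=
  inferInstanceAs (Group ↥(c.prescribed F F'))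

/-- The pointwise stabilizer `U(F)_A` of the finite set of vertices `A` in `U(F)`, as a subgroup
of `G(F, F')` (when `F ≤ F'`, one has `U(F) ≤ G(F, F')`). -/
def fixing (F F' : Subgroup (Equiv.Perm Ω)) (A : Finset V) : Subgroup (c.GroupG F F') where
  carrier := {g | g.1 ∈ c.burgerMozes F ∧ ∀ v ∈ A, g.1 v = v}
  one_mem' := ⟨(c.burgerMozes F).one_mem, fun _ _ => rfl⟩
  mul_mem' {g h} hg hh := ⟨(c.burgerMozes F).mul_mem hg.1 hh.1, fun v hv => by
    change g.1 (h.1 v) = v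
    rw [hh.2 v hv, hg.2 v hv]⟩
  inv_mem' {g} hg := ⟨(c.burgerMozes F).inv_mem hg.1, fun v hv => by
    change g.1.symm v = v
    rw [RelIso.symm_apply_eq, hg.2 v hv]⟩

theorem finite_neighborSet (c : LegalColoring T Ω) [Finite Ω] (v : V) :
    (T.neighborSet v).Finite :=
  Finite.of_equiv Ω (c.equivAt v).symm

theorem fixing_conj [Finite Ω] (F F' : Subgroup (Equiv.Perm Ω)) (g : c.GroupG F F')
    (A : Finset V) : ∃ B : Finset V, ∀ u ∈ c.fixing F F' B, g * u * g⁻¹ ∈ c.fixing F F' A := by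
  classical
  have hS : (c.singularities F g.1).Finite := g.2.1
  have hfin : (((g.1⁻¹ : T ≃g T) '' (A : Set V)) ∪ c.singularities F g.1 ∪
      ⋃ v ∈ c.singularities F g.1, T.neighborSet v).Finite :=
    ((A.finite_toSet.image _).union hS).union
      (hS.biUnion fun v _ => c.finite_neighborSet v)
  refine ⟨hfin.toFinset, fun u hu => ⟨fun v => ?_, fun v hv => ?_⟩⟩
  · have hmem : ∀ w, (w ∈ ((g.1⁻¹ : T ≃g T) '' (A : Set V)) ∪ c.singularities F g.1 ∪
        ⋃ v ∈ c.singularities F g.1, T.neighborSet v) → u.1 w = w :=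
      fun w hw => hu.2 w (hfin.mem_toFinset.2 hw)
    change c.localPerm (g.1 * u.1 * g.1⁻¹) v ∈ F
    rw [localPerm_mul, localPerm_mul, localPerm_inv]
    generalize (g.1⁻¹ : T ≃g T) v = w
    by_cases hw : w ∈ c.singularities F g.1
    · have h1 : u.1 w = w := hmem w (Or.inl (Or.inr hw))
      have h2 : c.localPerm u.1 w = 1 := c.localPerm_eq_one h1 fun x hx =>
        hmem x (Or.inr (Set.mem_biUnion hw hx))
      rw [h1, h2, mul_one, mul_inv_cancel]
      exact F.one_mem
    · have h1 : u.1 w ∉ c.singularities F g.1 := fun h => by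
        have h2 := hmem _ (Or.inl (Or.inr h))
        exact hw ((u.1.injective h2) ▸ h)
      exact F.mul_mem (F.mul_mem (not_not.1 h1) (hu.1 w)) (F.inv_mem (not_not.1 hw))
  · change g.1 (u.1 ((g.1⁻¹ : T ≃g T) v)) = v
    rw [hu.2 _ (hfin.mem_toFinset.2 (Or.inl (Or.inl ⟨v, hv, rfl⟩)))]
    exact g.1.apply_symm_apply v

/-- The group filter basis on `G(F, F')` given by the pointwise stabilizers in `U(F)` of finite
sets of vertices. -/
@[reducible] noncomputable def basisG [Finite Ω] (F F' : Subgroup (Equiv.Perm Ω)) : GroupFilterBasis (c.GroupG F F') :=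
  basisOfSubgroups (c.fixing F F')
    (fun A B => by
      classical
      exact ⟨A ∪ B, fun _ hu => ⟨⟨hu.1, fun v hv => hu.2 v (Finset.mem_union_left _ hv)⟩,
        ⟨hu.1, fun v hv => hu.2 v (Finset.mem_union_right _ hv)⟩⟩⟩)
    (c.fixing_conj F F')

/-- The group topology on `G(F, F')` for which the pointwise stabilizers in `U(F)` of finite sets
of vertices form a basis of neighbourhoods of the identity, i.e. the unique group topology for
which the inclusion of `U(F)` is continuous and open (see `isOpenEmbedding_inclusionG`). -/
noncomputable instance [Finite Ω] (F F' : Subgroup (Equiv.Perm Ω)) :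
    TopologicalSpace (c.GroupG F F') :=
  (c.basisG F F').topology

instance [Finite Ω] (F F' : Subgroup (Equiv.Perm Ω)) : IsTopologicalGroup (c.GroupG F F') :=
  (c.basisG F F').isTopologicalGroup

/-- The permutation topology on `Aut(T)`: pointwise convergence on the discrete set of
vertices. -/
@[reducible] def permTopology (T : SimpleGraph V) : TopologicalSpace (T ≃g T) :=
  TopologicalSpace.induced (fun (g : T ≃g T) (v : V) => g v)
    (@Pi.topologicalSpace V (fun _ => V) fun _ => ⊥)

theorem nhds_permTopology (g : T ≃g T) :
    (@nhds _ (permTopology T) g).HasBasis (fun _ : Finset V => True)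
      (fun A => {h | ∀ v ∈ A, h v = g v}) := by
  let : TopologicalSpace V := ⊥
  have : DiscreteTopology V := ⟨rfl⟩
  rw [nhds_induced, nhds_pi]
  simp only [nhds_discrete]
  refine Filter.hasBasis_iff.2 fun S => ?_
  rw [Filter.mem_comap]
  constructor
  · rintro ⟨t, ht, hS⟩
    obtain ⟨I, hI, t', ht', hsub⟩ := Filter.mem_pi.1 ht
    refine ⟨hI.toFinset, trivial, fun h hh => hS (hsub fun v hv => ?_)⟩
    have := hh v (hI.mem_toFinset.2 hv)
    change h v ∈ t' v
    rw [this]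
    exact Filter.mem_pure.1 (ht' v)
  · rintro ⟨A, -, hS⟩
    refine ⟨(A : Set V).pi fun v => {g v},
      Filter.pi_mem_pi A.finite_toSet fun v _ => Filter.mem_pure.2 rfl, fun h hh => hS ?_⟩
    exact fun v hv => hh v hv

/-- The inclusion of `U(F)` in `G(F, F')`. -/
def inclusionG {F F' : Subgroup (Equiv.Perm Ω)} (h : F ≤ F') :
    c.burgerMozes F →* c.GroupG F F' where
  toFun u := ⟨u.1, by
    have h0 : c.singularities F u.1 = ∅ :=
      Set.eq_empty_of_forall_notMem fun v hv => hv (u.2 v)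
    refine ⟨?_, fun v => h (u.2 v)⟩
    change (c.singularities F u.1).Finite
    rw [h0]
    exact Set.finite_empty⟩
  map_one' := rfl
  map_mul' _ _ := rfl

/-- The inclusion `U(F) ≤ G(F, F')` is continuous and open for the topology induced on `U(F)` by
the permutation topology. -/
theorem isOpenEmbedding_inclusionG [Finite Ω] {F F' : Subgroup (Equiv.Perm Ω)} (h : F ≤ F') :
    @Topology.IsOpenEmbedding (c.burgerMozes F) (c.GroupG F F')
      (@instTopologicalSpaceSubtype _ _ (permTopology T)) _
      (c.inclusionG h) := by
  let := permTopology T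
  have key : ∀ g : c.GroupG F F', (nhds g).HasBasis (fun _ : Finset V => True)
      (fun A => {x | g⁻¹ * x ∈ c.fixing F F' A}) := nhds_basisOfSubgroups _ _ _
  refine ⟨⟨⟨TopologicalSpace.ext_nhds fun u => ?_⟩, fun a b hab => ?_⟩, ?_⟩
  · refine (nhds_induced Subtype.val u).trans (Eq.trans ?_ (nhds_induced (c.inclusionG h) u).symm)
    refine ((nhds_permTopology u.1).comap _).eq_of_same_basis ?_
    convert (key _).comap _ using 2 with A
    ext x
    constructor
    · intro hx
      refine ⟨(c.burgerMozes F).mul_mem ((c.burgerMozes F).inv_mem u.2) x.2, fun v hv => ?_⟩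
      change u.1.symm (x.1 v) = v
      rw [hx v hv]
      exact u.1.symm_apply_apply v
    · intro hx v hv
      have := hx.2 v hv
      change u.1.symm (x.1 v) = v at this
      rwa [RelIso.symm_apply_eq] at this
  · have := congrArg Subtype.val hab
    exact Subtype.ext this
  · rw [isOpen_iff_mem_nhds]
    rintro _ ⟨u, rfl⟩
    refine (key _).mem_iff.2 ⟨∅, trivial, fun x hx => ?_⟩
    refine ⟨⟨x.1, ?_⟩, rfl⟩
    have := (c.burgerMozes F).mul_mem u.2 hx.1
    convert this
    change x.1 = u.1 * (u.1⁻¹ * x.1)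
    simp

end LegalColoring

end Tree

/-! ## The groups `L(D, D')` -/

section Wreath

variable {X : Type u}

/-- The permutational wreath product `A ≀ B = A^Y ⋊ B` of `A ≤ Sym(X)` and `B ≤ Sym(Y)`, with its
imprimitive action on `X × Y`. -/
def wreath {Y : Type v} (A : Subgroup (Equiv.Perm X)) (B : Subgroup (Equiv.Perm Y)) :
    Subgroup (Equiv.Perm (X × Y)) where
  carrier := {g | ∃ b ∈ B, ∃ f : Y → Equiv.Perm X, (∀ y, f y ∈ A) ∧
    ∀ x y, g (x, y) = (f y x, b y)}
  one_mem' := ⟨1, B.one_mem, fun _ => 1, fun _ => A.one_mem, fun _ _ => rfl⟩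
  mul_mem' := by
    rintro g h ⟨b, hb, f, hf, hg⟩ ⟨b', hb', f', hf', hh⟩
    refine ⟨b * b', B.mul_mem hb hb', fun y => f (b' y) * f' y,
      fun y => A.mul_mem (hf _) (hf' _), fun x y => ?_⟩
    rw [Equiv.Perm.mul_apply, hh, hg]
    rfl
  inv_mem' := by
    rintro g ⟨b, hb, f, hf, hg⟩
    refine ⟨b⁻¹, B.inv_mem hb, fun y => (f (b⁻¹ y))⁻¹, fun y => A.inv_mem (hf _), fun x y => ?_⟩
    rw [Equiv.Perm.inv_eq_iff_eq, hg]
    simp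

/-- The set `X^n`. -/
def Word (X : Type u) : ℕ → Type u
  | 0 => PUnit
  | n + 1 => X × Word X n

/-- The iterated wreath product `D_{n-1} ≀ ⋯ ≀ D_0` of permutation groups of `X`, acting
on `X^n`. -/
def iterWreath (D : ℕ → Subgroup (Equiv.Perm X)) : (n : ℕ) → Subgroup (Equiv.Perm (Word X n))
  | 0 => ⊥
  | n + 1 => wreath (D n) (iterWreath D n)

/-- The infinitely iterated wreath product `⋯ ≀ D_n ≀ ⋯ ≀ D_0`: the projective limit of the groups
`iterWreath D n` with respect to the natural projections, which are given by the action
on blocks. -/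
def infWreath (D : ℕ → Subgroup (Equiv.Perm X)) :
    Subgroup ((n : ℕ) → Equiv.Perm (Word X n)) where
  carrier := {g | (∀ n, g n ∈ iterWreath D n) ∧
    ∀ (n : ℕ) (x : X) (w : Word X n), (g (n + 1) (x, w)).2 = g n w}
  one_mem' := ⟨fun _ => Subgroup.one_mem _, fun _ _ _ => rfl⟩
  mul_mem' := by
    rintro g h ⟨hg, hg'⟩ ⟨hh, hh'⟩
    refine ⟨fun n => Subgroup.mul_mem _ (hg n) (hh n), fun n x w => ?_⟩
    change (g (n + 1) (h (n + 1) (x, w))).2 = g n (h n w)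
    rw [← hh' n x w]
    exact hg' n (h (n + 1) (x, w)).1 (h (n + 1) (x, w)).2
  inv_mem' := by
    rintro g ⟨hg, hg'⟩
    refine ⟨fun n => Subgroup.inv_mem _ (hg n), fun n x w => ?_⟩
    change ((g (n + 1))⁻¹ (x, w)).2 = (g n)⁻¹ w
    rw [Equiv.Perm.eq_inv_iff_eq]
    have h1 := hg' n ((g (n + 1))⁻¹ (x, w)).1 ((g (n + 1))⁻¹ (x, w)).2
    have h2 : g (n + 1) ((g (n + 1))⁻¹ (x, w)) = (x, w) :=
      Equiv.apply_symm_apply (g (n + 1)) (x, w)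
    exact h1.symm.trans (congrArg Prod.snd h2)

/-- Elements of the infinitely iterated wreath product in terms of local permutations. -/
theorem mem_infWreath_iff {D : ℕ → Subgroup (Equiv.Perm X)}
    {g : (n : ℕ) → Equiv.Perm (Word X n)} :
    g ∈ infWreath D ↔ ∀ n, ∃ f : Word X n → Equiv.Perm X, (∀ w, f w ∈ D n) ∧
      ∀ x w, g (n + 1) (x, w) = (f w x, g n w) := by
  constructor
  · rintro ⟨hg, hg'⟩ n
    obtain ⟨b, -, f, hf, h⟩ := hg (n + 1)
    refine ⟨f, hf, fun x w => ?_⟩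
    have h1 := hg' n x w
    rw [← h1]
    erw [h x w]
  · intro h
    refine ⟨fun n => ?_, fun n x w => ?_⟩
    · induction n with
      | zero =>
        refine Subgroup.mem_bot.2 (Equiv.ext fun w => ?_)
        change g 0 w = w
        cases w
        rfl
      | succ n ih =>
        obtain ⟨f, hf, hfg⟩ := h n
        exact ⟨g n, ih, f, hf, hfg⟩
    · obtain ⟨f, hf, hfg⟩ := h n
      rw [hfg]

theorem infWreath_mono {D E : ℕ → Subgroup (Equiv.Perm X)} (h : ∀ n, D n ≤ E n) :
    infWreath D ≤ infWreath E := fun _ hg =>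
  mem_infWreath_iff.2 fun n =>
    let ⟨f, hf, hfg⟩ := mem_infWreath_iff.1 hg n
    ⟨f, fun w => h n (hf w), hfg⟩

/-- `L_m = ⋯ ≀ D ≀ ⋯ ≀ D ≀ D' ≀ ⋯ ≀ D'`, where `D'` appears `m` times. -/
def stageL (D D' : Subgroup (Equiv.Perm X)) (m : ℕ) :
    Subgroup ((n : ℕ) → Equiv.Perm (Word X n)) :=
  infWreath fun n => if n < m then D' else D

theorem stageL_mono {D D' : Subgroup (Equiv.Perm X)} (h : D ≤ D') : Monotone (stageL D D') := by
  intro m m' hm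
  refine infWreath_mono fun n => ?_
  by_cases h1 : n < m
  · simp [h1, h1.trans_le hm]
  · by_cases h2 : n < m' <;> simp [h1, h2, h]

/-- The increasing union `⋃ L_m`, as a subgroup of the product of the groups `Sym(X^n)`. -/
def unionL {D D' : Subgroup (Equiv.Perm X)} (h : D ≤ D') :
    Subgroup ((n : ℕ) → Equiv.Perm (Word X n)) where
  carrier := {g | ∃ m, g ∈ stageL D D' m}
  one_mem' := ⟨0, Subgroup.one_mem _⟩
  mul_mem' := by
    rintro g g' ⟨m, hg⟩ ⟨m', hg'⟩
    exact ⟨max m m', Subgroup.mul_mem _ (stageL_mono h (le_max_left _ _) hg)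
      (stageL_mono h (le_max_right _ _) hg')⟩
  inv_mem' := by
    rintro g ⟨m, hg⟩
    exact ⟨m, Subgroup.inv_mem _ hg⟩

/-- The group `L(D, D')`, as a group of its own; its topology is defined below. -/
def GroupL {D D' : Subgroup (Equiv.Perm X)} (h : D ≤ D') : Type u := ↥(unionL h)

noncomputable instance {D D' : Subgroup (Equiv.Perm X)} (h : D ≤ D') : Group (GroupL h) :=
  inferInstanceAs (Group ↥(unionL h))

/-- The kernel `U_n` of the projection of `L_0` onto `W_n(D)`, as a subgroup of `L(D, D')`. -/
def kernelL {D D' : Subgroup (Equiv.Perm X)} (h : D ≤ D') (n : ℕ) : Subgroup (GroupL h) where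
  carrier := {g | g.1 ∈ stageL D D' 0 ∧ g.1 n = 1}
  one_mem' := ⟨Subgroup.one_mem _, rfl⟩
  mul_mem' {g g'} hg hg' := ⟨Subgroup.mul_mem _ hg.1 hg'.1, by
    change g.1 n * g'.1 n = 1
    rw [hg.2, hg'.2, one_mul]⟩
  inv_mem' {g} hg := ⟨Subgroup.inv_mem _ hg.1, by
    change (g.1 n)⁻¹ = 1
    rw [hg.2, inv_one]⟩

/-- If an element of the infinitely iterated wreath product acts trivially on `X^n`, then it acts
trivially on `X^k` for `k ≤ n`. -/
theorem eq_one_of_le [Nonempty X] {D : ℕ → Subgroup (Equiv.Perm X)}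
    {g : (n : ℕ) → Equiv.Perm (Word X n)} (hg : g ∈ infWreath D) {k n : ℕ} (hkn : k ≤ n)
    (h : g n = 1) : g k = 1 := by
  induction n, hkn using Nat.le_induction with
  | base => exact h
  | succ n _ ih =>
    refine ih (Equiv.ext fun w => ?_)
    have := hg.2 n (Classical.arbitrary X) w
    rw [← this, h]
    rfl

theorem kernelL_conj [Nonempty X] {D D' : Subgroup (Equiv.Perm X)} (h : D ≤ D') (g : GroupL h)
    (n : ℕ) : ∃ k, ∀ u ∈ kernelL h k, g * u * g⁻¹ ∈ kernelL h n := by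
  obtain ⟨m, hm⟩ := g.2
  refine ⟨max m n, fun u hu => ?_⟩
  have hum : u.1 ∈ stageL D D' m := stageL_mono h (Nat.zero_le m) hu.1
  have hconj : g.1 * u.1 * (g.1)⁻¹ ∈ stageL D D' m :=
    Subgroup.mul_mem _ (Subgroup.mul_mem _ hm hum) (Subgroup.inv_mem _ hm)
  have hk : (g.1 * u.1 * (g.1)⁻¹) (max m n) = 1 := by
    change g.1 _ * u.1 _ * (g.1 _)⁻¹ = 1
    rw [hu.2, mul_one, mul_inv_cancel]
  refine ⟨mem_infWreath_iff.2 fun i => ?_, eq_one_of_le hconj (le_max_right _ _) hk⟩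
  obtain ⟨f, hf, hfg⟩ := mem_infWreath_iff.1 hconj i
  by_cases hi : i < m
  · refine ⟨fun _ => 1, fun _ => by simp, fun x w => ?_⟩
    have h1 : (g.1 * u.1 * (g.1)⁻¹) (i + 1) = 1 :=
      eq_one_of_le hconj (Nat.succ_le_of_lt (lt_max_of_lt_left hi)) hk
    have h0 : (g.1 * u.1 * (g.1)⁻¹) i = 1 :=
      eq_one_of_le hconj (hi.le.trans (le_max_left _ _)) hk
    change (g.1 * u.1 * (g.1)⁻¹) (i + 1) (x, w) = (x, (g.1 * u.1 * (g.1)⁻¹) i w)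
    rw [h1, h0]
    rfl
  · exact ⟨f, fun w => by simpa [hi] using hf w, hfg⟩

/-- The group filter basis on `L(D, D')` given by the subgroups `U_n` of `L_0`. -/
@[reducible] noncomputable def basisL [Nonempty X] {D D' : Subgroup (Equiv.Perm X)} (h : D ≤ D') :
    GroupFilterBasis (GroupL h) :=
  basisOfSubgroups (kernelL h)
    (fun i j => ⟨max i j, fun _ hu => ⟨⟨hu.1, eq_one_of_le hu.1 (le_max_left _ _) hu.2⟩,
      ⟨hu.1, eq_one_of_le hu.1 (le_max_right _ _) hu.2⟩⟩⟩)
    (kernelL_conj h)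

/-- The group topology on `L(D, D')` for which the subgroups `U_n` of `L_0` form a basis of
neighbourhoods of the identity, i.e. the unique group topology for which the inclusion of the
profinite group `L_0` is continuous and open (see `isOpenEmbedding_inclusionL`). -/
noncomputable instance [Nonempty X] {D D' : Subgroup (Equiv.Perm X)} (h : D ≤ D') :
    TopologicalSpace (GroupL h) :=
  (basisL h).topology

instance [Nonempty X] {D D' : Subgroup (Equiv.Perm X)} (h : D ≤ D') :
    IsTopologicalGroup (GroupL h) :=
  (basisL h).isTopologicalGroup

/-- The topology on the product of the groups `Sym(X^n)`, each of them being discrete; it induces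
the profinite topology on a projective limit of finite groups. -/
@[reducible] def prodTopology (X : Type u) :
    TopologicalSpace ((n : ℕ) → Equiv.Perm (Word X n)) :=
  @Pi.topologicalSpace ℕ (fun n => Equiv.Perm (Word X n)) fun _ => ⊥

/-- The inclusion of `L_0` in `L(D, D')`. -/
def inclusionL {D D' : Subgroup (Equiv.Perm X)} (h : D ≤ D') : stageL D D' 0 →* GroupL h where
  toFun u := ⟨u.1, 0, u.2⟩
  map_one' := rfl
  map_mul' _ _ := rfl

/-- The inclusion `L_0 ≤ L(D, D')` is continuous and open for the profinite topology on `L_0`. -/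
theorem isOpenEmbedding_inclusionL [Nonempty X] {D D' : Subgroup (Equiv.Perm X)} (h : D ≤ D') :
    @Topology.IsOpenEmbedding (stageL D D' 0) (GroupL h)
      (@instTopologicalSpaceSubtype _ _ (prodTopology X)) _ (inclusionL h) := by
  let := prodTopology X
  have key : ∀ g : GroupL h, (nhds g).HasBasis (fun _ : ℕ => True)
      (fun n => {x | g⁻¹ * x ∈ kernelL h n}) := nhds_basisOfSubgroups _ _ _
  refine ⟨⟨⟨TopologicalSpace.ext_nhds fun u => ?_⟩, fun a b hab => ?_⟩, ?_⟩
  · rw [nhds_induced, nhds_induced]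
    refine Filter.ext fun S => ?_
    rw [((key _).comap _).mem_iff, Filter.mem_comap]
    constructor
    · rintro ⟨t, ht, hS⟩
      let : ∀ n, TopologicalSpace (Equiv.Perm (Word X n)) := fun _ => ⊥
      have : ∀ n, DiscreteTopology (Equiv.Perm (Word X n)) := fun _ => ⟨rfl⟩
      have ht' : t ∈ Filter.pi fun n => nhds (u.1 n) := by rwa [← nhds_pi]
      simp only [nhds_discrete] at ht'
      obtain ⟨I, hI, t', ht', hsub⟩ := Filter.mem_pi.1 ht'
      obtain ⟨N, hN⟩ := hI.bddAbove
      refine ⟨N, trivial, fun x hx => hS (hsub fun n hn => ?_)⟩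
      have h1 := eq_one_of_le hx.1 (hN hn) hx.2
      have h2 : x.1 n = u.1 n := (inv_mul_eq_one.1 h1).symm
      rw [h2]
      exact Filter.mem_pure.1 (ht' n)
    · rintro ⟨n, -, hS⟩
      refine ⟨(fun g : (n : ℕ) → Equiv.Perm (Word X n) => g n) ⁻¹' {u.1 n}, ?_, fun x hx => hS ?_⟩
      · let : ∀ n, TopologicalSpace (Equiv.Perm (Word X n)) := fun _ => ⊥
        have : ∀ n, DiscreteTopology (Equiv.Perm (Word X n)) := fun _ => ⟨rfl⟩
        exact (continuous_apply n).continuousAt.preimage_mem_nhds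
          ((isOpen_discrete _).mem_nhds rfl)
      · refine ⟨Subgroup.mul_mem _ (Subgroup.inv_mem _ u.2) x.2, ?_⟩
        exact inv_mul_eq_one.2 (Eq.symm hx)
  · have := congrArg Subtype.val hab
    exact Subtype.ext this
  · rw [isOpen_iff_mem_nhds]
    rintro _ ⟨u, rfl⟩
    refine (key _).mem_iff.2 ⟨0, trivial, fun x hx => ?_⟩
    refine ⟨⟨x.1, ?_⟩, rfl⟩
    have := Subgroup.mul_mem _ u.2 hx.1
    convert this
    change x.1 = u.1 * (u.1⁻¹ * x.1)
    simp

end Wreath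

end TreeLattice

/-! Suppose `Γ` is a lattice and let `U n` be a decreasing basis of open subgroups (kernels of the
action on words of length `n`, or fixators of balls). Discreteness gives `Γ ⊓ U n = ⊥` from some
rank on. Each `U n` sits in a larger group `K n` with a homomorphism onto a product of copies of
`D'` indexed by a finite set `I n` (words of length `n`, or a sphere), and `U n` is the preimage of
the product of the copies of `D`.

Essentiality improves `Γ ⊓ U n = ⊥` to `Γ ⊓ K n = ⊥` (`LocalAction.inf_eq_bot`): an element of `Γ ⊓
K n` has finite order, and its powers of prime order act locally through `D`, so they lie in `U n`.

Write `m n` for the measure of the image of `U n` in `G ⧸ Γ`, `s n = |I n|`, `A = |D|`, `B = (D' :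
D)`. Since `K n` embeds in `G ⧸ Γ`, the cosets of `U n` in `K n` give `B ^ s n` disjoint translates,
so `B ^ s n * m n` is at most the total mass (`le_measure_univ_of_disjoint`). Covering by cosets
gives `m n ≤ A ^ s n * m (n + 1)` (`measure_quotientOrbit_le`). With `s (n + 1) = (l + 1) * s n`,
the quantity `B ^ s n * m n` is multiplied at each step by at least `(B ^ l / A) ^ s n`, so it is
unbounded when `A < B ^ l` (`false_of_geometric_growth`). As `|D'| = A * B`, this inequality is
`|D'| < B ^ (l + 1)`, where `l + 1` is `ℓ` for words and `d - 1` for spheres.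

What remains is to realise the local actions: automorphisms with prescribed local permutations are
built level by level, transitivity of `F` serving to extend them beyond a sphere. The explicit
examples reduce to point stabilizers: all elements of prime order of the larger one lie in the
smaller one. -/

namespace TreeLattice

/-! ### Essential subgroups, and measures of orbits of open subgroups in `G ⧸ Γ`. -/

section Criterion

open scoped Pointwise

/-- A cyclic group of prime order has no proper non-trivial subgroup, so if `D` meets it
non-trivially then `D` contains it. Only this consequence of essentiality is used against lattices.
-/
theorem IsEssentialIn.mem_of_pow_prime_eq_one {P : Type*} [Group P] {D D' : Subgroup P}
    (h : IsEssentialIn D D') {x : P} (hx : x ∈ D') {p : ℕ} (hp : p.Prime) (hxp : x ^ p = 1) :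
    x ∈ D := by
  by_cases hx1 : x = 1
  · exact hx1 ▸ D.one_mem
  have hne : D ⊓ Subgroup.zpowers x ≠ ⊥ :=
    h.2 _ (by simpa using hx) (by simpa using hx1)
  obtain ⟨y, hy, hy1⟩ := (Subgroup.bot_or_exists_ne_one _).resolve_left hne
  have hox : orderOf x = p := orderOf_eq_prime hxp hx1 (hp := ⟨hp⟩)
  have : Fact (Nat.card (Subgroup.zpowers x)).Prime := ⟨by rwa [Nat.card_zpowers, hox]⟩
  rcases ((D ⊓ Subgroup.zpowers x).subgroupOf (Subgroup.zpowers x)).eq_bot_or_eq_top_of_prime_card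
    with h0 | h0
  · exfalso
    rw [Subgroup.subgroupOf_eq_bot, disjoint_iff] at h0
    exact hy1 (Subgroup.mem_bot.1 (h0 ▸ Subgroup.mem_inf.2 ⟨hy, hy.2⟩))
  · rw [Subgroup.subgroupOf_eq_top] at h0
    exact (h0 (Subgroup.mem_zpowers x)).1

variable {G : Type*} [Group G]

/-- A finite-order element all of whose prime order powers are excluded is trivial. -/
theorem eq_one_of_forall_prime_pow {g : G} (hg : IsOfFinOrder g)
    (h : ∀ k p : ℕ, p.Prime → (g ^ k) ^ p = 1 → g ^ k = 1) : g = 1 := by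
  by_contra hg1
  have ho : orderOf g ≠ 1 := by rwa [Ne, orderOf_eq_one_iff]
  obtain ⟨p, hp, k, hk⟩ := Nat.exists_prime_and_dvd ho
  have h0 : 0 < orderOf g := hg.orderOf_pos
  have h1 : g ^ k = 1 := h k p hp (by rw [← pow_mul, mul_comm, ← hk, pow_orderOf_eq_one])
  have hkpos : 0 < k := Nat.pos_of_ne_zero (by rintro rfl; simp [hk] at h0)
  have h2 := Nat.le_of_dvd hkpos (orderOf_dvd_of_pow_eq_one h1)
  have := hp.two_le
  nlinarith

/-- The image in `G ⧸ Γ` of a subgroup of `G`. -/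
def quotientOrbit (Γ V : Subgroup G) : Set (G ⧸ Γ) := (fun g : G => (g : G ⧸ Γ)) '' V

theorem mem_smul_quotientOrbit {Γ V : Subgroup G} {g h : G} (hgh : g⁻¹ * h ∈ V) :
    (h : G ⧸ Γ) ∈ g • quotientOrbit Γ V :=
  ⟨_, ⟨g⁻¹ * h, hgh, rfl⟩, by
    change ((g * (g⁻¹ * h) : G) : G ⧸ Γ) = _
    rw [mul_inv_cancel_left]⟩

theorem isOpen_quotientOrbit [TopologicalSpace G] [IsTopologicalGroup G] {Γ V : Subgroup G}
    (hV : IsOpen (V : Set G)) :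
    IsOpen (quotientOrbit Γ V) :=
  QuotientGroup.isOpenMap_coe _ hV

theorem exists_inf_eq_bot_of_discrete [TopologicalSpace G] {Γ : Subgroup G} (hΓ : DiscreteTopology Γ) {U : ℕ → Subgroup G}
    (hU : ∀ s ∈ nhds (1 : G), ∃ n, (U n : Set G) ⊆ s) : ∃ n, Γ ⊓ U n = ⊥ := by
  have h1 : ({1} : Set Γ) ∈ nhds (1 : Γ) := (isOpen_discrete _).mem_nhds rfl
  rw [nhds_subtype_eq_comap, Filter.mem_comap] at h1
  obtain ⟨s, hs, hs'⟩ := h1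
  obtain ⟨n, hn⟩ := hU s hs
  refine ⟨n, (Subgroup.eq_bot_iff_forall _).2 fun g hg => ?_⟩
  exact congrArg Subtype.val (hs' (show (⟨g, hg.1⟩ : Γ) ∈ Subtype.val ⁻¹' s from hn hg.2))

variable {Γ : Subgroup G} [MeasurableSpace (G ⧸ Γ)] {μ : Measure (G ⧸ Γ)}
  [SMulInvariantMeasure G (G ⧸ Γ) μ]

/-- Finitely many left translates of `V` cover `U`, and they have the same measure by invariance.
Subadditivity needs no measurability. -/
theorem measure_quotientOrbit_le {ι : Type*} [Fintype ι] {U V : Subgroup G} (r : ι → G)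
    (hr : ∀ g ∈ U, ∃ i, (r i)⁻¹ * g ∈ V) :
    μ (quotientOrbit Γ U) ≤ Fintype.card ι * μ (quotientOrbit Γ V) := by
  have hsub : quotientOrbit Γ U ⊆ ⋃ i ∈ Finset.univ, r i • quotientOrbit Γ V := by
    rintro _ ⟨g, hg, rfl⟩
    obtain ⟨i, hi⟩ := hr g hg
    exact Set.mem_biUnion (Finset.mem_univ i) (mem_smul_quotientOrbit hi)
  refine (measure_mono hsub).trans ((measure_biUnion_finset_le _ _).trans ?_)
  simp [measure_smul]

variable [TopologicalSpace G] [IsTopologicalGroup G]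

/-- Inner regularity yields a compact set of positive measure; it is covered by finitely many
translates of the open orbit, which would all be null. -/
theorem measure_quotientOrbit_pos [μ.Regular] (hμ : μ ≠ 0) {V : Subgroup G}
    (hV : IsOpen (V : Set G)) : 0 < μ (quotientOrbit Γ V) := by
  by_contra hcon
  have h0 : μ (quotientOrbit Γ V) = 0 := by simpa using hcon
  have huniv : 0 < μ Set.univ := by
    rw [pos_iff_ne_zero, Ne, Measure.measure_univ_eq_zero]
    exact hμ
  obtain ⟨C, -, hC, hCpos⟩ := isOpen_univ.exists_lt_isCompact huniv
  obtain ⟨t, ht⟩ := hC.elim_finite_subcover (fun g : G => g • quotientOrbit Γ V)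
    (fun g => (isOpen_quotientOrbit hV).smul g) (fun x _ => by
      obtain ⟨g, rfl⟩ := QuotientGroup.mk_surjective x
      exact Set.mem_iUnion.2 ⟨g, mem_smul_quotientOrbit (by simp [V.one_mem])⟩)
  have : μ C ≤ 0 := by
    refine (measure_mono ht).trans ((measure_biUnion_finset_le _ _).trans ?_)
    simp [measure_smul, h0]
  exact hCpos.not_ge this

/-- Because `Γ ⊓ K = ⊥`, the map `K → G ⧸ Γ` is injective, so distinct cosets of `V` in `K` have
disjoint images, all of equal measure. -/
theorem le_measure_univ_of_disjoint [BorelSpace (G ⧸ Γ)] {ι : Type*} [Fintype ι] {K V : Subgroup G}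
    (hV : IsOpen (V : Set G)) (hVK : V ≤ K) (hK : Γ ⊓ K = ⊥) (r : ι → G) (hrK : ∀ i, r i ∈ K)
    (hr : ∀ i j, (r i)⁻¹ * r j ∈ V → i = j) :
    Fintype.card ι * μ (quotientOrbit Γ V) ≤ μ Set.univ := by
  have hd : Pairwise (Function.onFun Disjoint fun i => r i • quotientOrbit Γ V) := by
    intro i j hij
    refine Set.disjoint_left.2 ?_
    rintro x ⟨_, ⟨v, hv, rfl⟩, rfl⟩ ⟨_, ⟨w, hw, rfl⟩, hvw⟩
    change ((r j * w : G) : G ⧸ Γ) = ((r i * v : G) : G ⧸ Γ) at hvw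
    rw [QuotientGroup.eq] at hvw
    have h1 : (r j * w)⁻¹ * (r i * v) ∈ Γ ⊓ K := ⟨hvw, K.mul_mem
      (K.inv_mem (K.mul_mem (hrK j) (hVK hw))) (K.mul_mem (hrK i) (hVK hv))⟩
    rw [hK, Subgroup.mem_bot, inv_mul_eq_one] at h1
    refine hij (hr i j ?_)
    have h2 : (r i)⁻¹ * r j = v * w⁻¹ := by
      rw [inv_mul_eq_iff_eq_mul, ← mul_assoc, ← h1, mul_inv_cancel_right]
    rw [h2]
    exact V.mul_mem hv (V.inv_mem hw)
  have h := tsum_meas_le_meas_iUnion_of_disjoint μ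
    (fun i => ((isOpen_quotientOrbit hV).smul (r i)).measurableSet) hd
  rw [tsum_fintype] at h
  simp only [measure_smul, Finset.sum_const, Finset.card_univ, nsmul_eq_mul] at h
  exact h.trans (measure_mono (Set.subset_univ _))

end Criterion

/-- A geometric growth estimate. -/
theorem false_of_geometric_growth {A B l : ℕ} (hA : 0 < A) (hAB : A < B ^ l) {s : ℕ → ℕ}
    (hs0 : 0 < s 0) (hs : ∀ n, s (n + 1) = (l + 1) * s n) {m : ℕ → ℝ} {n₀ : ℕ} {C : ℝ}
    (hpos : 0 < m n₀) (hstep : ∀ n, m n ≤ (A : ℝ) ^ s n * m (n + 1))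
    (hC : ∀ n, n₀ ≤ n → (B : ℝ) ^ s n * m n ≤ C) : False := by
  have hspos : ∀ n, 0 < s n := fun n => by
    induction n with
    | zero => exact hs0
    | succ n ih => rw [hs]; positivity
  have hB : 0 < B := by
    rcases Nat.eq_zero_or_pos B with rfl | h
    · rcases Nat.eq_zero_or_pos l with rfl | hl
      · simp at hAB; omega
      · rw [zero_pow hl.ne'] at hAB; omega
    · exact h
  set q : ℝ := (B : ℝ) ^ l / A with hq
  have hA' : (0 : ℝ) < A := by exact_mod_cast hA
  have hB' : (0 : ℝ) < B := by exact_mod_cast hB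
  have hq1 : 1 < q := by
    rw [hq, one_lt_div hA']
    exact_mod_cast hAB
  -- One factor `q` per step suffices for unboundedness, although the true factor is `q ^ s n`.
  have hgrow : ∀ k, 0 < m (n₀ + k) ∧
      q ^ k * ((B : ℝ) ^ s n₀ * m n₀) ≤ (B : ℝ) ^ s (n₀ + k) * m (n₀ + k) := by
    intro k
    induction k with
    | zero => simpa using hpos
    | succ k ih =>
      obtain ⟨ih0, ih⟩ := ih
      have h1 := hstep (n₀ + k)
      have h2 : 0 < m (n₀ + (k + 1)) :=
        pos_of_mul_pos_right (ih0.trans_le h1) (pow_pos hA' _).le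
      refine ⟨h2, ?_⟩
      have h3 : q ≤ q ^ s (n₀ + k) := le_self_pow₀ hq1.le (hspos _).ne'
      have h4 : q ^ s (n₀ + k) * ((B : ℝ) ^ s (n₀ + k) * m (n₀ + k)) ≤
          (B : ℝ) ^ s (n₀ + (k + 1)) * m (n₀ + (k + 1)) := by
        rw [← add_assoc, hs, hq, div_pow, add_mul, one_mul, pow_add, pow_mul, div_mul_eq_mul_div,
          div_le_iff₀ (pow_pos hA' _)]
        have := mul_le_mul_of_nonneg_left h1
          (by positivity : (0 : ℝ) ≤ ((B : ℝ) ^ l) ^ s (n₀ + k) * (B : ℝ) ^ s (n₀ + k))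
        nlinarith
      calc q ^ (k + 1) * ((B : ℝ) ^ s n₀ * m n₀)
          = q * (q ^ k * ((B : ℝ) ^ s n₀ * m n₀)) := by ring
        _ ≤ q * ((B : ℝ) ^ s (n₀ + k) * m (n₀ + k)) := by gcongr
        _ ≤ q ^ s (n₀ + k) * ((B : ℝ) ^ s (n₀ + k) * m (n₀ + k)) := by gcongr
        _ ≤ _ := h4
  have hr0 : 0 < (B : ℝ) ^ s n₀ * m n₀ := by positivity
  obtain ⟨k, hk⟩ := pow_unbounded_of_one_lt (C / ((B : ℝ) ^ s n₀ * m n₀)) hq1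
  rw [div_lt_iff₀ hr0] at hk
  exact absurd (hk.trans_le (hgrow k).2) (hC _ (Nat.le_add_right _ _)).not_gt

/-! ### The abstract criterion for the absence of lattices. -/

section LocalAction

variable {G P : Type*} [Group G] [Group P]

/-- A sequence of subgroups `U n ≤ K n` of `G`, where `K n` acts locally at finitely many places
through the groups `D' n i`, in such a way that `U n` consists of the elements of `K n` acting
locally through the subgroups `D n i`. -/
structure LocalAction (I : ℕ → Type*) (U K : ℕ → Subgroup G)
    (D D' : ∀ n, I n → Subgroup P) where
  /-- the local action at a place -/
  loc : ∀ n, I n → K n →* P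
  le : ∀ n, U n ≤ K n
  mem_iff : ∀ n (g : K n), (g : G) ∈ U n ↔ ∀ i, loc n i g ∈ D n i
  loc_mem : ∀ n i g, loc n i g ∈ D' n i
  exists_loc_eq : ∀ n (f : I n → P), (∀ i, f i ∈ D' n i) → ∃ g, ∀ i, loc n i g = f i
  mem_succ : ∀ n g, (∀ i, loc n i g = 1) → (g : G) ∈ U (n + 1)

namespace LocalAction

variable {I : ℕ → Type*} {U K : ℕ → Subgroup G} {D D' : ∀ n, I n → Subgroup P}

/-- Essentiality enters here. Triviality of `Γ` on `U n` propagates to `K n` because any element of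
prime order in `K n` has all its local actions in the subgroups `D n i`. -/
theorem inf_eq_bot [Finite P] (Λ : LocalAction I U K D D')
    (hD : ∀ n i, IsEssentialIn (D n i) (D' n i)) {Γ : Subgroup G} {n : ℕ} (h : Γ ⊓ U n = ⊥) : Γ ⊓ K n = ⊥ := by
  refine (Subgroup.eq_bot_iff_forall _).2 fun g hg => ?_
  have key : ∀ x : K n, (x : G) ∈ Γ → (x : G) ∈ U n → x = 1 := fun x hx hxU => by
    have : (x : G) ∈ Γ ⊓ U n := ⟨hx, hxU⟩
    rw [h, Subgroup.mem_bot] at this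
    exact Subtype.ext this
  have h1 : (⟨g, hg.2⟩ : K n) = 1 := by
    -- `K n` may be infinite; but the power with exponent `|P|` has trivial local actions, so it
    -- lies in `Γ ⊓ U n` and is trivial.
    refine eq_one_of_forall_prime_pow (isOfFinOrder_iff_pow_eq_one.2
      ⟨Nat.card P, Nat.card_pos, key _ (Γ.pow_mem hg.1 _) ((Λ.mem_iff _ _).2 fun i => ?_)⟩) ?_
    · rw [map_pow, pow_card_eq_one']
      exact one_mem _
    · intro k p hp hk
      refine key _ (Γ.pow_mem hg.1 _) ((Λ.mem_iff _ _).2 fun i => ?_)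
      exact (hD n i).mem_of_pow_prime_eq_one (Λ.loc_mem _ _ _) hp (by rw [← map_pow, hk, map_one])
  exact congrArg Subtype.val h1

/-- A topological group with a sufficiently rich local action has no lattice. -/
theorem not_hasLattice [TopologicalSpace G] [IsTopologicalGroup G] [Finite P]
    [∀ n, Finite (I n)] (Λ : LocalAction I U K D D')
    (hD : ∀ n i, IsEssentialIn (D n i) (D' n i)) {A B l : ℕ} (hopen : ∀ n, IsOpen (U n : Set G))
    (hbasis : ∀ s ∈ nhds (1 : G), ∃ n, (U n : Set G) ⊆ s)
    (hanti : Antitone U)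
    (hA : ∀ n i, Nat.card (D n i) = A) (hB : ∀ n i, (D n i).relIndex (D' n i) = B)
    (hI0 : 0 < Nat.card (I 0)) (hI : ∀ n, Nat.card (I (n + 1)) = (l + 1) * Nat.card (I n))
    (hAB : A < B ^ l) : ¬ HasLattice G := by
  rintro ⟨Γ, hΓ, _, _, μ, _, hμ, _, _⟩
  obtain ⟨n₀, hn₀⟩ := exists_inf_eq_bot_of_discrete hΓ hbasis
  have : ∀ n, Fintype (I n) := fun n => Fintype.ofFinite _
  have : Fintype P := Fintype.ofFinite _
  classical
  have hA0 : 0 < A := by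
    obtain ⟨i⟩ := (Nat.card_pos_iff.1 hI0).1
    rw [← hA 0 i]
    exact Nat.card_pos
  refine false_of_geometric_growth hA0 hAB (s := fun n => Nat.card (I n)) hI0 hI
    (m := fun n => μ.real (quotientOrbit Γ (U n))) (n₀ := n₀) (C := μ.real Set.univ)
    (ENNReal.toReal_pos (measure_quotientOrbit_pos hμ (hopen n₀)).ne' (measure_ne_top _ _)) ?_ ?_
  · intro n
    -- One element for each family of local actions in the `D n i`. They represent all cosets of `U
    -- (n + 1)` in `U n`, since elements with trivial local actions lie in `U (n + 1)`.
    choose r hr using fun f : ∀ i, D n i => Λ.exists_loc_eq n (fun i => f i)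
      fun i => (hD n i).1 (f i).2
    have h := measure_quotientOrbit_le (Γ := Γ) (μ := μ) (U := U n) (V := U (n + 1))
      (fun f => (r f : G)) fun g hg => by
        refine ⟨fun i => ⟨_, (Λ.mem_iff n ⟨g, Λ.le n hg⟩).1 hg i⟩,
          Λ.mem_succ n ((r _)⁻¹ * ⟨g, Λ.le n hg⟩) fun i => ?_⟩
        rw [map_mul, map_inv, hr]
        exact inv_mul_cancel _
    have hc : Fintype.card (∀ i, D n i) = A ^ Nat.card (I n) := by
      simp [← Nat.card_eq_fintype_card, Nat.card_pi, hA]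
    rw [hc] at h
    have h' := ENNReal.toReal_mono (by finiteness) h
    simpa [ENNReal.toReal_mul, Measure.real] using h'
  · intro n hn
    have hn' : Γ ⊓ U n = ⊥ := le_bot_iff.1 (hn₀ ▸ inf_le_inf_left Γ (hanti hn))
    -- Representatives of distinct cosets of `U n` in `K n`, one for each family of cosets of `D n
    -- i` in `D' n i`.
    choose r hr using fun q : ∀ i, D' n i ⧸ (D n i).subgroupOf (D' n i) =>
      Λ.exists_loc_eq n (fun i => (q i).out) fun i => (q i).out.2
    have : ∀ i, Fintype (D' n i ⧸ (D n i).subgroupOf (D' n i)) := fun i => Fintype.ofFinite _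
    have h := le_measure_univ_of_disjoint (μ := μ) (hopen n) (Λ.le n) (Λ.inf_eq_bot hD hn')
      (fun q => (r q : G)) (fun q => (r q).2) fun q q' hqq' => by
        funext i
        have h1 := (Λ.mem_iff n ((r q)⁻¹ * r q')).1 hqq' i
        rw [map_mul, map_inv, hr, hr] at h1
        rw [← (q i).out_eq, ← (q' i).out_eq]
        exact QuotientGroup.eq.2 h1
    have hc : Fintype.card (∀ i, D' n i ⧸ (D n i).subgroupOf (D' n i)) = B ^ Nat.card (I n) := by
      have : ∀ i, Nat.card (D' n i ⧸ (D n i).subgroupOf (D' n i)) = B := fun i => hB n i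
      simp [← Nat.card_eq_fintype_card, Nat.card_pi, this]
    rw [hc] at h
    have h' := ENNReal.toReal_mono (by finiteness) h
    simpa [ENNReal.toReal_mul, Measure.real] using h'

/-- The diagonal local action of a power of a group. -/
def pi (Λ : LocalAction I U K D D') (κ : Type*) :
    LocalAction (fun n => κ × I n) (fun n => Subgroup.pi Set.univ fun _ : κ => U n)
      (fun n => Subgroup.pi Set.univ fun _ : κ => K n) (fun n i => D n i.2)
      (fun n i => D' n i.2) where
  loc n i := (Λ.loc n i.2).comp
    { toFun := fun g => ⟨g.1 i.1, g.2 i.1 trivial⟩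
      map_one' := rfl
      map_mul' := fun _ _ => rfl }
  le n g hg j hj := Λ.le n (hg j hj)
  mem_iff n g := by
    constructor
    · intro hg i
      exact (Λ.mem_iff n ⟨g.1 i.1, g.2 i.1 trivial⟩).1 (hg i.1 trivial) i.2
    · intro hg j _
      exact (Λ.mem_iff n ⟨g.1 j, g.2 j trivial⟩).2 fun i => hg (j, i)
  loc_mem n i g := Λ.loc_mem n i.2 _
  exists_loc_eq n f hf := by
    choose r hr using fun j => Λ.exists_loc_eq n (fun i => f (j, i)) fun i => hf (j, i)
    exact ⟨⟨fun j => r j, fun j _ => (r j).2⟩, fun i => hr i.1 i.2⟩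
  mem_succ n g hg j _ := Λ.mem_succ n ⟨g.1 j, g.2 j trivial⟩ fun i => hg (j, i)

end LocalAction

end LocalAction

/-! ### Neighbourhoods of the identity in a topology given by subgroups. -/

section BasisOfSubgroups

universe u v

variable {G : Type u} [Group G] {ι : Type v} [Nonempty ι] (B : ι → Subgroup G)
  (inter : ∀ i j, ∃ k, B k ≤ B i ⊓ B j)
  (conj : ∀ (g : G) (i : ι), ∃ j, ∀ u ∈ B j, g * u * g⁻¹ ∈ B i)

theorem exists_subset_of_mem_nhds_one {s : Set G}
    (hs : s ∈ @nhds G (basisOfSubgroups B inter conj).topology 1) : ∃ i, (B i : Set G) ⊆ s := by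
  obtain ⟨i, -, hi⟩ := (nhds_basisOfSubgroups B inter conj 1).mem_iff.1 hs
  exact ⟨i, fun g hg => hi (by simpa using hg)⟩

theorem isOpen_basisOfSubgroups (i : ι) :
    @IsOpen G (basisOfSubgroups B inter conj).topology (B i : Set G) := by
  let := (basisOfSubgroups B inter conj).topology
  have := (basisOfSubgroups B inter conj).isTopologicalGroup
  refine Subgroup.isOpen_of_mem_nhds (B i) (g := 1) ?_
  exact (nhds_basisOfSubgroups B inter conj 1).mem_iff.2 ⟨i, trivial, fun g hg => by simpa using hg⟩

end BasisOfSubgroups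

/-! ### Local actions on words: the groups `L(D, D')` and their powers. -/

section Wreath

universe u

variable {X : Type u}

/-- The automorphism of the rooted tree of words with given local permutations. -/
def ofLocal (σ : ∀ m, Word X m → Equiv.Perm X) : ∀ m, Equiv.Perm (Word X m)
  | 0 => 1
  | m + 1 =>
    { toFun := fun y => (σ m y.2 y.1, ofLocal σ m y.2)
      invFun := fun y => ((σ m ((ofLocal σ m).symm y.2)).symm y.1, (ofLocal σ m).symm y.2)
      left_inv := fun y => Prod.ext (by simp) (by simp)
      right_inv := fun y => Prod.ext (by simp) (by simp) }

theorem ofLocal_succ (σ : ∀ m, Word X m → Equiv.Perm X) (m : ℕ) (x : X) (w : Word X m) :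
    ofLocal σ (m + 1) (x, w) = (σ m w x, ofLocal σ m w) := rfl

theorem ofLocal_mem {σ : ∀ m, Word X m → Equiv.Perm X} {D : ℕ → Subgroup (Equiv.Perm X)}
    (h : ∀ m w, σ m w ∈ D m) : ofLocal σ ∈ infWreath D :=
  mem_infWreath_iff.2 fun m => ⟨σ m, h m, fun _ _ => rfl⟩

theorem ofLocal_eq_one {σ : ∀ m, Word X m → Equiv.Perm X} {n : ℕ}
    (h : ∀ m < n, ∀ w, σ m w = 1) : ofLocal σ n = 1 := by
  induction n with
  | zero => rfl
  | succ n ih =>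
    refine Equiv.ext fun y => ?_
    change (σ n y.2 y.1, ofLocal σ n y.2) = y
    rw [h n (Nat.lt_succ_self n), ih fun m hm => h m (hm.trans (Nat.lt_succ_self n))]
    rfl

instance finite_word (X : Type u) [Finite X] : ∀ n, Finite (Word X n)
  | 0 => inferInstanceAs (Finite PUnit)
  | n + 1 =>
    have := finite_word X n
    inferInstanceAs (Finite (X × Word X n))

theorem card_word_zero : Nat.card (Word X 0) = 1 := by
  change Nat.card PUnit = 1
  simp

theorem card_word_succ (n : ℕ) :
    Nat.card (Word X (n + 1)) = Nat.card X * Nat.card (Word X n) :=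
  Nat.card_prod X (Word X n)

variable {D D' : Subgroup (Equiv.Perm X)} (h : D ≤ D')

/-- The subgroup of `L(D, D')` of elements acting trivially on `X^n`, with local permutations in
`D'` on `X^n` and in `D` on the words of length `> n`. -/
def levelL (n : ℕ) : Subgroup (GroupL h) where
  carrier := {g | g.1 ∈ infWreath (fun i => if i = n then D' else D) ∧ g.1 n = 1}
  one_mem' := ⟨Subgroup.one_mem _, rfl⟩
  mul_mem' {g g'} hg hg' := ⟨Subgroup.mul_mem _ hg.1 hg'.1, by
    change g.1 n * g'.1 n = 1
    rw [hg.2, hg'.2, one_mul]⟩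
  inv_mem' {g} hg := ⟨Subgroup.inv_mem _ hg.1, by
    change (g.1 n)⁻¹ = 1
    rw [hg.2, inv_one]⟩

theorem levelL_apply_snd {n : ℕ} {g : GroupL h} (hg : g ∈ levelL h n) (x : X) (w : Word X n) :
    g.1 (n + 1) (x, w) = ((g.1 (n + 1) (x, w)).1, w) :=
  Prod.ext rfl ((hg.1.2 n x w).trans (by rw [hg.2]; rfl))

/-- The local permutation at the word `w` of length `n` of an element acting trivially
on `X^n`. -/
noncomputable def locL (n : ℕ) (w : Word X n) : levelL h n →* Equiv.Perm X where
  toFun g :=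
    { toFun := fun x => (g.1.1 (n + 1) (x, w)).1
      invFun := fun x => ((g⁻¹).1.1 (n + 1) (x, w)).1
      left_inv := fun x => by
        have h1 := levelL_apply_snd h g.2 x w
        have h2 : (g⁻¹).1.1 (n + 1) (g.1.1 (n + 1) (x, w)) = (x, w) :=
          Equiv.symm_apply_apply (g.1.1 (n + 1)) (x, w)
        rw [h1] at h2
        exact congrArg Prod.fst h2
      right_inv := fun x => by
        have h1 := levelL_apply_snd h (g⁻¹).2 x w
        have h2 : g.1.1 (n + 1) ((g⁻¹).1.1 (n + 1) (x, w)) = (x, w) :=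
          Equiv.apply_symm_apply (g.1.1 (n + 1)) (x, w)
        rw [h1] at h2
        exact congrArg Prod.fst h2 }
  map_one' := rfl
  map_mul' g g' := Equiv.ext fun x => by
    change (g.1.1 (n + 1) (g'.1.1 (n + 1) (x, w))).1 =
      (g.1.1 (n + 1) ((g'.1.1 (n + 1) (x, w)).1, w)).1
    rw [← levelL_apply_snd h g'.2 x w]

theorem locL_eq {n : ℕ} (g : levelL h n) {f : Word X n → Equiv.Perm X}
    (hf : ∀ x w, g.1.1 (n + 1) (x, w) = (f w x, g.1.1 n w)) (w : Word X n) :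
    locL h n w g = f w := Equiv.ext fun x => congrArg Prod.fst (hf x w)

theorem mem_stageL_zero_iff {g : ∀ n, Equiv.Perm (Word X n)} :
    g ∈ stageL D D' 0 ↔ g ∈ infWreath fun _ => D := by
  change _ ∈ infWreath _ ↔ _
  simp

/-- The local action of the subgroups `levelL h n` on words. -/
noncomputable def localActionL : LocalAction (fun n => Word X n) (kernelL h) (levelL h)
    (fun _ _ => D) (fun _ _ => D') where
  loc := locL h
  le n g hg := ⟨infWreath_mono (fun i => by by_cases hi : i = n <;> simp [hi, h])
    (mem_stageL_zero_iff.1 hg.1), hg.2⟩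
  mem_iff n g := by
    constructor
    · intro hg w
      obtain ⟨f, hf, hfg⟩ := mem_infWreath_iff.1 (mem_stageL_zero_iff.1 hg.1) n
      rw [locL_eq h g hfg]
      exact hf w
    · intro hg
      refine ⟨mem_stageL_zero_iff.2 (mem_infWreath_iff.2 fun m => ?_), g.2.2⟩
      obtain ⟨f, hf, hfg⟩ := mem_infWreath_iff.1 g.2.1 m
      refine ⟨f, fun w => ?_, hfg⟩
      by_cases hm : m = n
      · subst hm
        rw [← locL_eq h g hfg]
        exact hg w
      · simpa [hm] using hf w
  loc_mem n w g := by
    obtain ⟨f, hf, hfg⟩ := mem_infWreath_iff.1 g.2.1 n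
    rw [locL_eq h g hfg]
    simpa using hf w
  exists_loc_eq n f hf := by
    -- The local permutations are concentrated on level `n`, so the element acts trivially on `X^n`
    -- and belongs to `L_{n+1}`.
    let σ : ∀ m, Word X m → Equiv.Perm X := fun m w => if hm : m = n then f (hm ▸ w) else 1
    have hσ : ∀ m w, σ m w ∈ if m = n then D' else D := fun m w => by
      by_cases hm : m = n
      · subst hm
        simpa [σ] using hf w
      · simp [σ, hm]
    refine ⟨⟨⟨ofLocal σ, n + 1, infWreath_mono (fun i => ?_) (ofLocal_mem hσ)⟩,
      ofLocal_mem hσ, ofLocal_eq_one fun m hm w => ?_⟩, fun w => ?_⟩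
    · rcases lt_trichotomy i n with hi | rfl | hi
      · simp [hi.ne, hi.trans (Nat.lt_succ_self n), h]
      · simp
      · simp [hi.ne', show ¬ i < n + 1 by omega]
    · simp [σ, hm.ne]
    · refine (locL_eq h _ (fun x w => ofLocal_succ σ n x w) w).trans ?_
      simp [σ]
  mem_succ n g hg := by
    have key : ∀ m, ∃ f : Word X m → Equiv.Perm X, (∀ w, f w ∈ D) ∧
        ∀ x w, g.1.1 (m + 1) (x, w) = (f w x, g.1.1 m w) := fun m => by
      obtain ⟨f, hf, hfg⟩ := mem_infWreath_iff.1 g.2.1 m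
      refine ⟨f, fun w => ?_, hfg⟩
      by_cases hm : m = n
      · subst hm
        rw [← locL_eq h g hfg, hg]
        exact one_mem D
      · simpa [hm] using hf w
    refine ⟨mem_stageL_zero_iff.2 (mem_infWreath_iff.2 key), Equiv.ext fun y => ?_⟩
    have h1 := levelL_apply_snd h g.2 y.1 y.2
    have h2 := congrArg (fun p : Equiv.Perm X => p y.1) (hg y.2)
    exact h1.trans (Prod.ext h2 rfl)

/-- A power with `k` factors acts at `k * ℓ ^ n` places. The growth ratio is still `ℓ`, so the
numerical condition does not depend on `k`. -/
theorem not_hasLattice_pi_groupL [Finite X] [Nonempty X] (hX : 2 ≤ Nat.card X)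
    (hD : IsEssentialIn D D') (hcard : Nat.card D' < D.relIndex D' ^ Nat.card X) {k : ℕ}
    (hk : 1 ≤ k) : ¬ HasLattice (Fin k → GroupL h) := by
  have hanti : Antitone (kernelL h) := fun i j hij g hg => ⟨hg.1, eq_one_of_le hg.1 hij hg.2⟩
  obtain ⟨l, hl⟩ : ∃ l, Nat.card X = l + 1 := ⟨Nat.card X - 1, by omega⟩
  refine ((localActionL h).pi (Fin k)).not_hasLattice (A := Nat.card D) (B := D.relIndex D')
    (l := l) (fun _ _ => hD) (fun n => ?_) (fun s hs => ?_) (fun i j hij g hg a ha => ?_)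
    (fun _ _ => rfl) (fun _ _ => rfl) ?_ (fun n => ?_) ?_
  · rw [Subgroup.coe_pi]
    exact isOpen_set_pi Set.finite_univ fun _ _ => isOpen_basisOfSubgroups (kernelL h) _ _ n
  · rw [nhds_pi, Filter.mem_pi] at hs
    obtain ⟨J, hJ, t, ht, hts⟩ := hs
    choose N hN using fun j => exists_subset_of_mem_nhds_one (kernelL h) _ _ (ht j)
    refine ⟨Finset.univ.sup N, fun g hg => hts fun j _ => hN j ?_⟩
    exact hanti (Finset.le_sup (Finset.mem_univ j)) (hg j trivial)
  · exact hanti hij (hg a ha)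
  · rw [Nat.card_prod, card_word_zero]
    simpa using Nat.pos_of_ne_zero (Nat.one_le_iff_ne_zero.1 hk)
  · rw [Nat.card_prod, Nat.card_prod, card_word_succ, hl]
    ring
  -- Writing `|D'| = |D| * (D' : D)` and cancelling one factor `(D' : D)` turns the hypothesis into
  -- `A < B ^ l`.
  · rw [← Subgroup.relIndex_bot_left, ← Subgroup.relIndex_mul_relIndex ⊥ D D' bot_le h, hl,
      pow_succ, Subgroup.relIndex_bot_left] at hcard
    exact lt_of_mul_lt_mul_right hcard (Nat.zero_le _)

end Wreath

/-! ### Rooted geometry of a legally coloured tree, and automorphisms with prescribed local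
permutations. -/

section TreeAut

universe u v

variable {V : Type v} {Ω : Type u} {T : SimpleGraph V}

/-- Geodesics from `r` through `u` and through `u'` are two paths from `r` to `w`, and paths in a
tree are unique. This makes the parent of a vertex well defined. -/
theorem eq_of_adj_of_dist_add_one (hT : T.IsTree) {r u u' w : V} (h : T.Adj u w)
    (h' : T.Adj u' w) (hd : T.dist r u + 1 = T.dist r w) (hd' : T.dist r u' + 1 = T.dist r w) :
    u = u' := by
  obtain ⟨p, hp⟩ := hT.connected.exists_walk_length_eq_dist r u
  obtain ⟨p', hp'⟩ := hT.connected.exists_walk_length_eq_dist r u'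
  have h1 : (p.concat h).IsPath :=
    SimpleGraph.Walk.isPath_of_length_eq_dist _ (by rw [SimpleGraph.Walk.length_concat, hp, hd])
  have h2 : (p'.concat h').IsPath :=
    SimpleGraph.Walk.isPath_of_length_eq_dist _ (by rw [SimpleGraph.Walk.length_concat, hp', hd'])
  exact (SimpleGraph.Walk.concat_inj ((hT.existsUnique_path r w).unique h1 h2)).1

namespace LegalColoring

variable (c : LegalColoring T Ω)

/-- The neighbour of `v` along the edge of colour `a`. -/
noncomputable def nbr (v : V) (a : Ω) : V := ((c.equivAt v).symm a).1

theorem adj_nbr (v : V) (a : Ω) : T.Adj v (c.nbr v a) := ((c.equivAt v).symm a).2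

theorem exists_nbr_eq {v w : V} (h : T.Adj v w) : ∃ a, c.nbr v a = w :=
  ⟨c.equivAt v ⟨w, h⟩, by simp [nbr]⟩

theorem nbr_injective (v : V) : Function.Injective (c.nbr v) := fun _ _ h =>
  (c.equivAt v).symm.injective (Subtype.ext h)

theorem color_nbr (v : V) (a : Ω) : c.color ⟨s(v, c.nbr v a), c.adj_nbr v a⟩ = a :=
  (c.equivAt v).apply_symm_apply a

@[simp]
theorem nbr_nbr (v : V) (a : Ω) : c.nbr (c.nbr v a) a = v := by
  have h : c.equivAt (c.nbr v a) ⟨v, (c.adj_nbr v a).symm⟩ = a := by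
    refine Eq.trans ?_ (c.color_nbr v a)
    change c.color _ = c.color _
    congr 2
    exact Sym2.eq_swap
  conv_lhs => rw [nbr, (Equiv.symm_apply_eq _).2 h.symm]

theorem apply_nbr (g : T ≃g T) (v : V) (a : Ω) :
    g (c.nbr v a) = c.nbr (g v) (c.localPerm g v a) := by
  obtain ⟨w, rfl⟩ := (c.equivAt v).surjective a
  rw [localPerm_equivAt, nbr, nbr, Equiv.symm_apply_apply, Equiv.symm_apply_apply]
  rfl

theorem localPerm_eq {g : T ≃g T} {v : V} {σ : Equiv.Perm Ω}
    (h : ∀ a, g (c.nbr v a) = c.nbr (g v) (σ a)) : c.localPerm g v = σ :=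
  Equiv.ext fun a => c.nbr_injective (g v) (by rw [← apply_nbr, h])

/-- The local permutation of `g` at `v` fixes the colours of the edges around `v` fixed by `g`. -/
theorem localPerm_apply_of_fixed {g : T ≃g T} {v : V} {a : Ω} (hv : g v = v)
    (hn : g (c.nbr v a) = c.nbr v a) : c.localPerm g v a = a :=
  c.nbr_injective v (by rw [← hn, apply_nbr, hv])

theorem localPerm_mul_of_fixed {g h : T ≃g T} {v : V} (hv : h v = v) :
    c.localPerm (g * h) v = c.localPerm g v * c.localPerm h v := by
  rw [localPerm_mul, hv]

section Rooted

variable (r : V)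

theorem dist_nbr (hT : T.IsTree) (v : V) (a : Ω) :
    T.dist r (c.nbr v a) = T.dist r v + 1 ∨ T.dist r (c.nbr v a) + 1 = T.dist r v := by
  rcases hT.dist_eq_dist_add_one_of_adj r (c.adj_nbr v a) with h | h
  · exact Or.inr h.symm
  · exact Or.inl h

theorem exists_dist_nbr_add_one (hT : T.IsTree) {v : V} (hv : T.dist r v ≠ 0) :
    ∃ a, T.dist r (c.nbr v a) + 1 = T.dist r v := by
  obtain ⟨p, hp⟩ := hT.connected.exists_walk_length_eq_dist v r
  rw [SimpleGraph.dist_comm] at hp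
  cases p with
  | nil => exact absurd SimpleGraph.dist_self hv
  | cons h p =>
    obtain ⟨a, rfl⟩ := c.exists_nbr_eq h
    refine ⟨a, (c.dist_nbr r hT v a).resolve_left fun h' => ?_⟩
    have := SimpleGraph.dist_le p
    rw [SimpleGraph.dist_comm] at this
    rw [SimpleGraph.Walk.length_cons] at hp
    omega

/-- The colour of the first edge on the path from `v` to the root `r`. -/
noncomputable def parentColor [Nonempty Ω] (v : V) : Ω :=
  -- At the root no colour qualifies and the value is arbitrary; hence the recurring assumption
  -- `T.dist r v ≠ 0`.
  Classical.epsilon fun a => T.dist r (c.nbr v a) + 1 = T.dist r v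

variable [Nonempty Ω]

/-- The neighbour of `v` that is the closest to the root `r`. -/
noncomputable def parent (v : V) : V := c.nbr v (c.parentColor r v)

variable (hT : T.IsTree)

include c hT

theorem dist_parent {v : V} (hv : T.dist r v ≠ 0) : T.dist r (c.parent r v) + 1 = T.dist r v :=
  Classical.epsilon_spec (c.exists_dist_nbr_add_one r hT hv)

theorem parentColor_eq {v : V} {a : Ω} (h : T.dist r (c.nbr v a) + 1 = T.dist r v) :
    c.parentColor r v = a :=
  c.nbr_injective v (eq_of_adj_of_dist_add_one hT (c.adj_nbr v _).symm (c.adj_nbr v a).symm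
    (c.dist_parent r hT (by omega)) h)

theorem parentColor_nbr {v : V} {a : Ω} (h : T.dist r (c.nbr v a) = T.dist r v + 1) :
    c.parentColor r (c.nbr v a) = a :=
  c.parentColor_eq r hT (by rw [nbr_nbr, h])

theorem parent_nbr {v : V} {a : Ω} (h : T.dist r (c.nbr v a) = T.dist r v + 1) :
    c.parent r (c.nbr v a) = v := by
  rw [parent, parentColor_nbr c r hT h, nbr_nbr]

theorem dist_nbr_of_ne {v : V} {a : Ω} (h : T.dist r v ≠ 0 → a ≠ c.parentColor r v) :
    T.dist r (c.nbr v a) = T.dist r v + 1 :=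
  (c.dist_nbr r hT v a).resolve_right fun h' => h (by omega) (c.parentColor_eq r hT h').symm

omit hT in
theorem nbr_parent (v : V) : c.nbr (c.parent r v) (c.parentColor r v) = v := c.nbr_nbr _ _

theorem finite_ball [Finite Ω] (n : ℕ) : {v | T.dist r v ≤ n}.Finite := by
  induction n with
  | zero =>
    refine (Set.finite_singleton r).subset fun v hv => ?_
    exact ((hT.connected.dist_eq_zero_iff).1 (Nat.le_zero.1 hv)).symm
  | succ n ih =>
    refine (ih.union ((ih.prod (Set.finite_univ (α := Ω))).image fun p => c.nbr p.1 p.2)).subset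
      fun v hv => ?_
    rcases Nat.lt_or_ge (T.dist r v) (n + 1) with h | h
    · exact Or.inl (Nat.lt_succ_iff.1 h)
    · have := c.dist_parent r hT (v := v) (by omega)
      have hv' : T.dist r v ≤ n + 1 := hv
      exact Or.inr ⟨(c.parent r v, c.parentColor r v), ⟨show T.dist r (c.parent r v) ≤ n by omega, trivial⟩,
        c.nbr_parent r v⟩

/-- The number of vertices on the spheres around a vertex. -/
theorem card_sphere_succ [Finite Ω] (n : ℕ) :
    Nat.card {v // T.dist r v = n + 1 + 1} =
      (Nat.card Ω - 1) * Nat.card {v // T.dist r v = n + 1} := by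
  classical
  have : Fintype Ω := Fintype.ofFinite Ω
  have hfin : Finite {v // T.dist r v = n + 1} :=
    ((c.finite_ball r hT (n + 1)).subset fun v (hv : T.dist r v = n + 1) => hv.le).to_subtype
  have : Fintype {v // T.dist r v = n + 1} := Fintype.ofFinite _
  -- A vertex is encoded by its parent and the colour of the edge joining them, which can be any
  -- colour except that of the parent's own edge towards the root. The root has no such excluded
  -- colour, so the recursion starts at radius `1`.
  let e : {v // T.dist r v = n + 1 + 1} ≃
      Σ w : {v // T.dist r v = n + 1}, {a // a ≠ c.parentColor r w.1} :=
    { toFun := fun v => ⟨⟨c.parent r v.1, by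
          have := c.dist_parent r hT (v := v.1) (by rw [v.2]; omega)
          have := v.2
          omega⟩, ⟨c.parentColor r v.1, fun h => by
          have h1 := c.dist_parent r hT (v := v.1) (by rw [v.2]; omega)
          have h2 := c.dist_parent r hT (v := c.parent r v.1) (by have := v.2; omega)
          change c.parentColor r v.1 = c.parentColor r (c.parent r v.1) at h
          rw [parent, ← h, nbr_parent] at h2
          omega⟩⟩
      invFun := fun p => ⟨c.nbr p.1.1 p.2.1, by
          rw [c.dist_nbr_of_ne r hT fun _ => p.2.2, p.1.2]⟩
      left_inv := fun v => Subtype.ext (c.nbr_parent r v.1)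
      right_inv := by
        rintro ⟨⟨w, hw⟩, ⟨a, ha⟩⟩
        have h := c.dist_nbr_of_ne r hT (v := w) fun _ => ha
        have h1 := c.parent_nbr r hT h
        have h2 := c.parentColor_nbr r hT h
        refine Sigma.ext (Subtype.ext h1) ?_
        refine (Subtype.heq_iff_coe_eq fun x => ?_).2 h2
        simp only [h1] }
  rw [Nat.card_congr e, Nat.card_sigma]
  simp [Nat.card_eq_fintype_card, Fintype.card_subtype_compl, mul_comm]

theorem card_sphere_one_pos [Finite Ω] : 0 < Nat.card {v // T.dist r v = 0 + 1} := by
  have hfin : Finite {v // T.dist r v = 0 + 1} :=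
    ((c.finite_ball r hT 1).subset fun v (hv : T.dist r v = 0 + 1) => hv.le).to_subtype
  obtain ⟨a⟩ := ‹Nonempty Ω›
  exact Nat.card_pos_iff.2 ⟨⟨⟨c.nbr r a, by
    rw [SimpleGraph.dist_eq_one_iff_adj.2 (c.adj_nbr r a)]⟩⟩, hfin⟩

section Extend

-- The condition `hσ` says that the two ends of each edge prescribe the same colour for its image.
-- It is the only obstruction to realising `σ`.
variable {σ : V → Equiv.Perm Ω}
  (hσ : ∀ v, T.dist r v ≠ 0 → σ v (c.parentColor r v) = σ (c.parent r v) (c.parentColor r v))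

omit hT

/-- Auxiliary to `image`: the recursion is on the distance to the root. -/
noncomputable def imageAux (σ : V → Equiv.Perm Ω) : ℕ → V → V
  | 0, _ => r
  | m + 1, v =>
    c.nbr (imageAux σ m (c.parent r v)) (σ (c.parent r v) (c.parentColor r v))

/-- The map on vertices fixing `r` with given local permutations. -/
noncomputable def image (σ : V → Equiv.Perm Ω) (v : V) : V := c.imageAux r σ (T.dist r v) v

theorem image_root : c.image r σ r = r := by
  rw [image, SimpleGraph.dist_self]
  rfl

include hT

theorem image_eq_nbr {v : V} (hv : T.dist r v ≠ 0) :
    c.image r σ v = c.nbr (c.image r σ (c.parent r v)) (σ (c.parent r v) (c.parentColor r v)) := by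
  rw [image, ← c.dist_parent r hT hv]
  rfl

include hσ

/-- Away from the root this is the recursive construction; towards the root it is the compatibility
`hσ`, since following the same colour twice leads back. -/
theorem image_nbr (v : V) (a : Ω) :
    c.image r σ (c.nbr v a) = c.nbr (c.image r σ v) (σ v a) := by
  rcases c.dist_nbr r hT v a with h | h
  · rw [c.image_eq_nbr r hT (by omega), c.parent_nbr r hT h, c.parentColor_nbr r hT h]
  · have h1 := c.parentColor_eq r hT h
    have h0 : T.dist r v ≠ 0 := by omega
    have h2 := hσ v h0
    have h3 := c.image_eq_nbr r hT (σ := σ) h0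
    rw [← h2] at h3
    rw [parent, h1] at h3
    rw [h3, nbr_nbr]

/-- The two claims need a joint induction: if the edge towards the root is sent to the edge towards
the root, then any other edge at that vertex is sent away from the root, and no backtracking occurs.
-/
theorem dist_image (n : ℕ) : ∀ v, T.dist r v = n → T.dist r (c.image r σ v) = n ∧
    (n ≠ 0 → c.parentColor r (c.image r σ v) = σ v (c.parentColor r v)) := by
  induction n with
  | zero =>
    intro v hv
    obtain rfl := (hT.connected.dist_eq_zero_iff).1 hv
    rw [image_root]
    simp
  | succ n ih =>
    intro v hv
    have hv0 : T.dist r v ≠ 0 := by omega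
    have hp := c.dist_parent r hT hv0
    obtain ⟨ih1, ih2⟩ := ih (c.parent r v) (by omega)
    have h1 : T.dist r (c.image r σ v) = n + 1 := by
      rw [c.image_eq_nbr r hT hv0, c.dist_nbr_of_ne r hT, ih1]
      intro h0 h
      rw [ih2 (by omega), (σ _).apply_eq_iff_eq] at h
      have h2 := c.dist_parent r hT (v := c.parent r v) (by omega)
      rw [parent, ← h, nbr_parent] at h2
      omega
    refine ⟨h1, fun _ => ?_⟩
    rw [c.image_eq_nbr r hT hv0] at h1 ⊢
    rw [c.parentColor_nbr r hT (by rw [h1, ih1]), hσ v hv0]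

theorem parent_image {v : V} (hv : T.dist r v ≠ 0) :
    c.parent r (c.image r σ v) = c.image r σ (c.parent r v) := by
  rw [parent, ((c.dist_image r hT hσ _ v rfl).2 hv), parent, c.image_nbr r hT hσ]

theorem image_injective : Function.Injective (c.image r σ) := by
  have key : ∀ n, ∀ v w, T.dist r v = n → T.dist r w = n → c.image r σ v = c.image r σ w →
      v = w := by
    intro n
    induction n with
    | zero =>
      intro v w hv hw _
      rw [← (hT.connected.dist_eq_zero_iff).1 hv, ← (hT.connected.dist_eq_zero_iff).1 hw]
    | succ n ih =>
      intro v w hv hw h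
      have hv0 : T.dist r v ≠ 0 := by omega
      have hw0 : T.dist r w ≠ 0 := by omega
      have h1 := c.dist_parent r hT hv0
      have h2 := c.dist_parent r hT hw0
      have hp : c.parent r v = c.parent r w := ih _ _ (by omega) (by omega) (by
        rw [← c.parent_image r hT hσ hv0, ← c.parent_image r hT hσ hw0, h])
      rw [c.image_eq_nbr r hT hv0, c.image_eq_nbr r hT hw0, hp] at h
      rw [← c.nbr_parent r v, ← c.nbr_parent r w, hp, (σ _).injective (c.nbr_injective _ h)]
  intro v w h
  refine key _ v w rfl ?_ h
  rw [← (c.dist_image r hT hσ _ v rfl).1, ← (c.dist_image r hT hσ _ w rfl).1, h]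

theorem image_surjective : Function.Surjective (c.image r σ) := by
  have key : ∀ n, ∀ w, T.dist r w = n → ∃ v, c.image r σ v = w := by
    intro n
    induction n with
    | zero =>
      intro w hw
      exact ⟨r, by rw [image_root, (hT.connected.dist_eq_zero_iff).1 hw]⟩
    | succ n ih =>
      intro w hw
      have h1 := c.dist_parent r hT (v := w) (by omega)
      obtain ⟨v, hv⟩ := ih (c.parent r w) (by omega)
      refine ⟨c.nbr v ((σ v).symm (c.parentColor r w)), ?_⟩
      rw [c.image_nbr r hT hσ, hv, Equiv.apply_symm_apply, nbr_parent]
  exact fun w => key _ w rfl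

/-- There is an automorphism of a legally coloured tree fixing a given root with prescribed
local permutations, provided that these are compatible along edges. -/
theorem exists_localPerm_eq : ∃ g : T ≃g T, g r = r ∧ ∀ v, c.localPerm g v = σ v := by
  have hadj : ∀ {v w}, T.Adj (c.image r σ v) (c.image r σ w) ↔ T.Adj v w := by
    intro v w
    constructor
    · intro h
      obtain ⟨a, ha⟩ := c.exists_nbr_eq h
      rw [← (σ v).apply_symm_apply a, ← c.image_nbr r hT hσ] at ha
      rw [← c.image_injective r hT hσ ha]
      exact c.adj_nbr _ _
    · intro h
      obtain ⟨a, rfl⟩ := c.exists_nbr_eq h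
      rw [c.image_nbr r hT hσ]
      exact c.adj_nbr _ _
  exact ⟨⟨Equiv.ofBijective _ ⟨c.image_injective r hT hσ, c.image_surjective r hT hσ⟩, hadj⟩,
    c.image_root r, fun v => c.localPerm_eq (c.image_nbr r hT hσ v)⟩

end Extend

end Rooted

end LegalColoring

end TreeAut

/-! ### Transport of essential subgroups and point stabilizers by conjugation. -/

section Conjugation

theorem IsEssentialIn.map {G H : Type*} [Group G] [Group H] {A B : Subgroup G}
    (h : IsEssentialIn A B) {f : G →* H} (hf : Function.Injective f) :
    IsEssentialIn (A.map f) (B.map f) := by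
  refine ⟨Subgroup.map_mono h.1, fun S hS hS1 hAS => ?_⟩
  obtain ⟨y, hyS, hy1⟩ := (Subgroup.bot_or_exists_ne_one _).resolve_left hS1
  obtain ⟨x, hx, rfl⟩ := hS hyS
  have h1 : S.comap f ⊓ B ≠ ⊥ := fun h0 => by
    have h2 : x ∈ S.comap f ⊓ B := ⟨hyS, hx⟩
    rw [h0, Subgroup.mem_bot] at h2
    exact hy1 (by rw [h2, map_one])
  obtain ⟨z, hz, hz1⟩ :=
    (Subgroup.bot_or_exists_ne_one _).resolve_left (h.2 _ inf_le_right h1)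
  have h3 : f z ∈ A.map f ⊓ S := ⟨Subgroup.mem_map_of_mem f hz.1, hz.2.1⟩
  rw [hAS, Subgroup.mem_bot] at h3
  exact hz1 (hf (by rw [h3, map_one]))

theorem map_conj_pointStab {Ω : Type*} {F : Subgroup (Equiv.Perm Ω)} {τ : Equiv.Perm Ω}
    (hτ : τ ∈ F) (a : Ω) :
    (pointStab F a).map (MulAut.conj τ).toMonoidHom = pointStab F (τ a) := by
  ext x
  rw [Subgroup.mem_map]
  constructor
  · rintro ⟨y, ⟨hy, hya⟩, rfl⟩
    refine ⟨F.mul_mem (F.mul_mem hτ hy) (F.inv_mem hτ), ?_⟩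
    have hya' : y a = a := hya
    change (τ * y * τ⁻¹) (τ a) = τ a
    simp [hya']
  · rintro ⟨hx, hxa⟩
    have hxa' : x (τ a) = τ a := hxa
    refine ⟨τ⁻¹ * x * τ, ⟨F.mul_mem (F.mul_mem (F.inv_mem hτ) hx) hτ, ?_⟩, ?_⟩
    · change (τ⁻¹ * x * τ) a = a
      simp [hxa']
    · simp [mul_assoc]

end Conjugation

/-! ### Local actions on spheres: the groups `G(F, F')`. -/

section Prescribed

universe u v

variable {V : Type v} {Ω : Type u} {T : SimpleGraph V}

namespace LegalColoring

variable (c : LegalColoring T Ω) [Nonempty Ω] (r : V)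

/-- Given permutations on the sphere of radius `n` fixing the colours towards the root, there is
an automorphism with these local permutations on the sphere, fixing the ball of radius `n`
and having its other local permutations in the transitive group `F`. -/
theorem exists_localPerm_eq_on_sphere (hT : T.IsTree) {F : Subgroup (Equiv.Perm Ω)}
    (hF : MulAction.IsPretransitive F Ω) (n : ℕ) (s : V → Equiv.Perm Ω)
    (hs : ∀ v, T.dist r v = n → s v (c.parentColor r v) = c.parentColor r v) :
    ∃ g : T ≃g T, (∀ v, T.dist r v ≤ n → g v = v) ∧ (∀ v, T.dist r v = n → c.localPerm g v = s v) ∧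
      ∀ v, T.dist r v ≠ n → c.localPerm g v ∈ F := by
  classical
  choose t ht using fun a b : Ω => hF.exists_smul_eq a b
  -- Beyond the sphere, each vertex receives an element of `F` that agrees with the permutation at
  -- its parent on the colour of the joining edge; transitivity of `F` provides it. The recursion is
  -- on the distance to the sphere.
  let sig : ℕ → V → Equiv.Perm Ω := fun k => Nat.rec (fun v => s v)
    (fun _ f v => (t (c.parentColor r v) (f (c.parent r v) (c.parentColor r v)) : Equiv.Perm Ω)) k
  let σ : V → Equiv.Perm Ω := fun v => if T.dist r v < n then 1 else sig (T.dist r v - n) v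
  have hlt : ∀ v, T.dist r v < n → σ v = 1 := fun v hv => if_pos hv
  have heq : ∀ v, T.dist r v = n → σ v = s v := fun v hv => by
    simp only [σ, hv, lt_irrefl, if_false, Nat.sub_self]
    rfl
  have hgt : ∀ v, n < T.dist r v → σ v =
      (t (c.parentColor r v) (σ (c.parent r v) (c.parentColor r v)) : Equiv.Perm Ω) := by
    intro v hv
    have h := c.dist_parent r hT (v := v) (by omega)
    have h1 : T.dist r v - n = (T.dist r (c.parent r v) - n) + 1 := by omega
    simp only [σ, if_neg hv.not_gt, if_neg (show ¬ T.dist r (c.parent r v) < n by omega), h1]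
    rfl
  have hσ : ∀ v, T.dist r v ≠ 0 →
      σ v (c.parentColor r v) = σ (c.parent r v) (c.parentColor r v) := by
    intro v hv
    have h := c.dist_parent r hT hv
    rcases lt_trichotomy (T.dist r v) n with h1 | h1 | h1
    · rw [hlt v h1, hlt _ (by omega)]
    · rw [heq v h1, hlt _ (by omega), hs v h1]
      rfl
    · rw [hgt v h1]
      exact ht _ _
  obtain ⟨g, hgr, hg⟩ := c.exists_localPerm_eq r hT hσ
  refine ⟨g, ?_, fun v hv => by rw [hg, heq v hv], fun v hv => ?_⟩
  · have key : ∀ m, ∀ v, T.dist r v = m → m ≤ n → g v = v := by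
      intro m
      induction m with
      | zero =>
        intro v hv _
        rw [← (hT.connected.dist_eq_zero_iff).1 hv, hgr]
      | succ m ih =>
        intro v hv hm
        have h := c.dist_parent r hT (v := v) (by omega)
        rw [← c.nbr_parent r v, apply_nbr, ih _ (by omega) (by omega), hg, hlt _ (by omega)]
        rfl
    exact fun v hv => key _ v rfl hv
  · rw [hg]
    rcases lt_or_gt_of_ne hv with h1 | h1
    · rw [hlt v h1]
      exact F.one_mem
    · rw [hgt v h1]
      exact Subtype.prop _

/-- The subgroup of `G(F, F')` of elements fixing the ball of radius `n`, with local permutations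
in the prescribed groups `E b` on the sphere and in `F` elsewhere. -/
def sphereGroup (F F' : Subgroup (Equiv.Perm Ω)) (E : Ω → Subgroup (Equiv.Perm Ω)) (n : ℕ) :
    Subgroup (c.GroupG F F') where
  carrier := {g | (∀ v, T.dist r v ≤ n → g.1 v = v) ∧
    (∀ v, T.dist r v = n → c.localPerm g.1 v ∈ E (c.parentColor r v)) ∧
      ∀ v, T.dist r v ≠ n → c.localPerm g.1 v ∈ F}
  one_mem' := ⟨fun _ _ => rfl, fun v _ => by
    change c.localPerm 1 v ∈ _
    rw [localPerm_one]
    exact one_mem _, fun v _ => by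
    change c.localPerm 1 v ∈ _
    rw [localPerm_one]
    exact one_mem _⟩
  mul_mem' {g h} hg hh := by
    -- The sphere is fixed pointwise, so by injectivity no other vertex is mapped into it.
    have key : ∀ v, T.dist r v ≠ n → T.dist r (h.1 v) ≠ n := fun v hv hn => by
      have h1 := hh.1 _ hn.le
      rw [h.1.injective h1] at hn
      exact hv hn
    refine ⟨fun v hv => ?_, fun v hv => ?_, fun v hv => ?_⟩
    · change g.1 (h.1 v) = v
      rw [hh.1 v hv, hg.1 v hv]
    · change c.localPerm (g.1 * h.1) v ∈ _
      rw [localPerm_mul, hh.1 v hv.le]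
      exact mul_mem (hg.2.1 v hv) (hh.2.1 v hv)
    · change c.localPerm (g.1 * h.1) v ∈ _
      rw [localPerm_mul]
      exact mul_mem (hg.2.2 _ (key v hv)) (hh.2.2 v hv)
  inv_mem' {g} hg := by
    have hfix : ∀ v, T.dist r v ≤ n → (g.1⁻¹ : T ≃g T) v = v := fun v hv => by
      change g.1.symm v = v
      rw [RelIso.symm_apply_eq, hg.1 v hv]
    refine ⟨hfix, fun v hv => ?_, fun v hv => ?_⟩
    · change c.localPerm g.1⁻¹ v ∈ _
      rw [localPerm_inv, hfix v hv.le]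
      exact inv_mem (hg.2.1 v hv)
    · change c.localPerm g.1⁻¹ v ∈ _
      rw [localPerm_inv]
      refine inv_mem (hg.2.2 _ fun hn => hv ?_)
      have h1 := hg.1 _ hn.le
      change g.1 (g.1.symm v) = _ at h1
      rw [RelIso.apply_symm_apply] at h1
      rwa [← h1] at hn

/-- The ball of radius `n` around `r`. -/
noncomputable def ball [Finite Ω] (hT : T.IsTree) (n : ℕ) : Finset V :=
  (c.finite_ball r hT n).toFinset

theorem mem_ball [Finite Ω] (hT : T.IsTree) {n : ℕ} {v : V} :
    v ∈ c.ball r hT n ↔ T.dist r v ≤ n :=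
  (c.finite_ball r hT n).mem_toFinset

theorem localPerm_parentColor (hT : T.IsTree) {n : ℕ} {g : T ≃g T}
    (hg : ∀ v, T.dist r v ≤ n + 1 → g v = v) {v : V} (hv : T.dist r v = n + 1) :
    c.localPerm g v (c.parentColor r v) = c.parentColor r v := by
  refine c.localPerm_apply_of_fixed (hg v hv.le) (hg _ ?_)
  have h := c.dist_parent r hT (v := v) (by omega)
  change T.dist r (c.parent r v) ≤ _
  omega

/-- The local action of the subgroups `sphereGroup` on the spheres. -/
noncomputable def localActionG [Finite Ω] (hT : T.IsTree) {F F' : Subgroup (Equiv.Perm Ω)}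
    (hFF' : F ≤ F') (hF : MulAction.IsPretransitive F Ω) {E : Ω → Subgroup (Equiv.Perm Ω)}
    (hFE : ∀ b, pointStab F b ≤ E b) (hE : ∀ b, E b ≤ pointStab F' b) :
    LocalAction (fun n => {v // T.dist r v = n + 1})
      (fun n => c.fixing F F' (c.ball r hT (n + 1))) (fun n => c.sphereGroup r F F' E (n + 1))
      (fun _ v => pointStab F (c.parentColor r v.1)) (fun _ v => E (c.parentColor r v.1)) where
  loc n v :=
    { toFun := fun g => c.localPerm g.1.1 v.1
      map_one' := c.localPerm_one v.1
      map_mul' := fun _ h => c.localPerm_mul_of_fixed (h.2.1 v.1 v.2.le) }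
  le n g hg := by
    have hfix : ∀ v, T.dist r v ≤ n + 1 → g.1 v = v := fun v hv => hg.2 v ((c.mem_ball r hT).2 hv)
    exact ⟨hfix, fun v hv => hFE _ ⟨hg.1 v, c.localPerm_parentColor r hT hfix hv⟩,
      fun v _ => hg.1 v⟩
  mem_iff n g := by
    constructor
    · exact fun hg v => ⟨hg.1 v.1, c.localPerm_parentColor r hT g.2.1 v.2⟩
    · intro hg
      refine ⟨fun v => ?_, fun v hv => g.2.1 v ((c.mem_ball r hT).1 hv)⟩
      by_cases hv : T.dist r v = n + 1
      · exact (hg ⟨v, hv⟩).1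
      · exact g.2.2.2 v hv
  loc_mem n v g := g.2.2.1 v.1 v.2
  exists_loc_eq n f hf := by
    classical
    obtain ⟨g, hg1, hg2, hg3⟩ := c.exists_localPerm_eq_on_sphere r hT hF (n + 1)
      (fun v => if hv : T.dist r v = n + 1 then f ⟨v, hv⟩ else 1) fun v hv => by
        rw [dif_pos hv]
        exact (hE _ (hf ⟨v, hv⟩)).2
    have hg2' : ∀ v (hv : T.dist r v = n + 1), c.localPerm g v = f ⟨v, hv⟩ := fun v hv => by
      rw [hg2 v hv, dif_pos hv]
    have hgE : ∀ v, T.dist r v = n + 1 → c.localPerm g v ∈ E (c.parentColor r v) := fun v hv => by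
      rw [hg2' v hv]
      exact hf ⟨v, hv⟩
    -- The singularities all lie on the sphere, which is finite, so the automorphism does belong to
    -- `G(F, F')`.
    refine ⟨⟨⟨g, (c.finite_ball r hT (n + 1)).subset fun v hv => ?_, fun v => ?_⟩,
      hg1, hgE, hg3⟩, fun v => hg2' v.1 v.2⟩
    · by_contra h
      exact hv (hg3 v fun h' => h h'.le)
    · by_cases hv : T.dist r v = n + 1
      · exact (hE _ (hgE v hv)).1
      · exact hFF' (hg3 v hv)
  mem_succ n g hg := by
    refine ⟨fun v => ?_, fun v hv => ?_⟩
    · by_cases hv : T.dist r v = n + 1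
      · have h : c.localPerm g.1.1 v = 1 := hg ⟨v, hv⟩
        rw [h]
        exact F.one_mem
      · exact g.2.2.2 v hv
    · rw [mem_ball] at hv
      rcases Nat.lt_or_ge (n + 1) (T.dist r v) with h | h
      · have h1 := c.dist_parent r hT (v := v) (by omega)
        have h2 : T.dist r (c.parent r v) = n + 1 := by omega
        have h3 : c.localPerm g.1.1 (c.parent r v) = 1 := hg ⟨_, h2⟩
        rw [← c.nbr_parent r v, apply_nbr, g.2.1 _ h2.le, h3]
        rfl
      · exact g.2.1 v h

omit [Nonempty Ω] in
theorem fixing_anti (F F' : Subgroup (Equiv.Perm Ω)) {A B : Finset V} (h : A ⊆ B) :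
    c.fixing F F' B ≤ c.fixing F F' A := fun _ hg => ⟨hg.1, fun v hv => hg.2 v (h hv)⟩

omit [Nonempty Ω] in
theorem not_hasLattice_groupG [Finite Ω] (hΩ : 3 ≤ Nat.card Ω) (hT : T.IsTree)
    {F F' : Subgroup (Equiv.Perm Ω)} (hFF' : F ≤ F') (hF : MulAction.IsPretransitive F Ω) (a : Ω)
    {D' : Subgroup (Equiv.Perm Ω)} (hD' : D' ≤ pointStab F' a)
    (hess : IsEssentialIn (pointStab F a) D')
    (hcard : Nat.card D' < (pointStab F a).relIndex D' ^ (Nat.card Ω - 1)) :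
    ¬ HasLattice (c.GroupG F F') := by
  have : Nonempty Ω := ⟨a⟩
  obtain ⟨r⟩ := hT.connected.nonempty
  choose τ hτ using fun b : Ω => hF.exists_smul_eq a b
  have hτ' : ∀ b, (τ b : Equiv.Perm Ω) a = b := hτ
  -- The colour towards the root varies along the sphere, while `D'` is given at `a` only.
  -- Conjugating by elements of `F` that carry `a` to `b` gives a copy at each `b`, with the same
  -- order, index and essentiality.
  let E : Ω → Subgroup (Equiv.Perm Ω) := fun b =>
    D'.map (MulAut.conj (τ b : Equiv.Perm Ω)).toMonoidHom
  have hinj : ∀ b, Function.Injective (MulAut.conj (τ b : Equiv.Perm Ω)).toMonoidHom :=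
    fun b => (MulAut.conj _).injective
  have hstab : ∀ b, (pointStab F a).map (MulAut.conj (τ b : Equiv.Perm Ω)).toMonoidHom =
      pointStab F b := fun b => by rw [map_conj_pointStab (τ b).2, hτ']
  have hE : ∀ b, IsEssentialIn (pointStab F b) (E b) := fun b => hstab b ▸ hess.map (hinj b)
  have hE' : ∀ b, E b ≤ pointStab F' b := fun b => by
    have h := map_conj_pointStab (hFF' (τ b).2) a
    rw [hτ'] at h
    exact h ▸ Subgroup.map_mono hD'
  have hfin : ∀ n, Finite {v // T.dist r v = n + 1} := fun n =>
    ((c.finite_ball r hT (n + 1)).subset fun v (hv : T.dist r v = n + 1) => hv.le).to_subtype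
  -- Spheres grow by the factor `d - 1`, so `l = d - 2`.
  obtain ⟨l, hl⟩ : ∃ l, Nat.card Ω - 1 = l + 1 := ⟨Nat.card Ω - 2, by omega⟩
  refine (c.localActionG r hT hFF' hF (fun b => (hE b).1) hE').not_hasLattice
    (A := Nat.card (pointStab F a)) (B := (pointStab F a).relIndex D') (l := l)
    (fun _ v => hE _) (fun n => isOpen_basisOfSubgroups (c.fixing F F') _ _ _) (fun s hs => ?_)
    (fun i j hij => c.fixing_anti F F' fun v hv => ?_) (fun _ v => ?_) (fun _ v => ?_)
    (c.card_sphere_one_pos r hT) (fun n => ?_) ?_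
  · obtain ⟨A, hA⟩ := exists_subset_of_mem_nhds_one (c.fixing F F') _ _ hs
    refine ⟨A.sup fun v => T.dist r v, fun g hg => hA ⟨hg.1, fun v hv => hg.2 v ?_⟩⟩
    rw [mem_ball]
    exact (Finset.le_sup (f := fun v => T.dist r v) hv).trans (Nat.le_succ _)
  · rw [mem_ball] at hv ⊢
    omega
  · rw [← hstab]
    exact (Nat.card_congr ((pointStab F a).equivMapOfInjective _ (hinj _)).toEquiv).symm
  · rw [← hstab]
    exact Subgroup.relIndex_map_map_of_injective _ _ (hinj _)
  · rw [c.card_sphere_succ r hT, hl]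
  · rw [← Subgroup.relIndex_bot_left, ← Subgroup.relIndex_mul_relIndex ⊥ _ D' bot_le hess.1, hl,
      pow_succ, Subgroup.relIndex_bot_left] at hcard
    exact lt_of_mul_lt_mul_right hcard (Nat.zero_le _)

end LegalColoring

end Prescribed

/-- Every non-trivial subgroup of a finite group contains an element of prime order. This is how
essentiality is verified in the examples. -/
theorem isEssentialIn_of_prime {P : Type*} [Group P] [Finite P] {D D' : Subgroup P} (hD : D ≤ D')
    (h : ∀ x ∈ D', ∀ p : ℕ, p.Prime → x ^ p = 1 → x ∈ D) : IsEssentialIn D D' := by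
  refine ⟨hD, fun S hS hS1 hDS => ?_⟩
  obtain ⟨y, hy, hy1⟩ := (Subgroup.bot_or_exists_ne_one _).resolve_left hS1
  refine hy1 (eq_one_of_forall_prime_pow (isOfFinOrder_of_finite y) fun k p hp hk => ?_)
  have h1 : y ^ k ∈ D ⊓ S := ⟨h _ (hS (S.pow_mem hy k)) p hp hk, S.pow_mem hy k⟩
  rwa [hDS, Subgroup.mem_bot] at h1

/-! ### The example of `PSL(2, q)` and `PGL(2, q)` on the projective line. -/

section ProjectiveLine

variable (K : Type*) [Field K]

/-- The group `PGL(2, K)` as a permutation group of the projective line. -/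
abbrev permPGL : Subgroup (Equiv.Perm (ℙ K (Fin 2 → K))) :=
  (MulAction.toPermHom (Matrix.GeneralLinearGroup (Fin 2) K) (ℙ K (Fin 2 → K))).range

/-- The group `PSL(2, K)` as a permutation group of the projective line. -/
abbrev permPSL : Subgroup (Equiv.Perm (ℙ K (Fin 2 → K))) :=
  (MulAction.toPermHom (Matrix.SpecialLinearGroup (Fin 2) K) (ℙ K (Fin 2 → K))).range

theorem permPSL_isPretransitive : MulAction.IsPretransitive (permPSL K) (ℙ K (Fin 2 → K)) :=
  ⟨fun x y => by
    obtain ⟨g, hg⟩ := MulAction.exists_smul_eq (Matrix.SpecialLinearGroup (Fin 2) K) x y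
    exact ⟨⟨_, g, rfl⟩, hg⟩⟩

variable {K}

/-- Proportional matrices act in the same way on the projective line. -/
theorem toPermHom_eq_of_eq_smul {G H : Type*} [Group G] [DistribMulAction G (Fin 2 → K)]
    [SMulCommClass G K (Fin 2 → K)] [Group H] [DistribMulAction H (Fin 2 → K)]
    [SMulCommClass H K (Fin 2 → K)] {g : G} {h : H} (s : K)
    (hs : ∀ v : Fin 2 → K, g • v = s • (h • v)) :
    MulAction.toPermHom G (ℙ K (Fin 2 → K)) g = MulAction.toPermHom H (ℙ K (Fin 2 → K)) h := by
  refine Equiv.ext fun x => ?_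
  induction x using Projectivization.ind with
  | _ v hv =>
    change g • Projectivization.mk K v hv = h • Projectivization.mk K v hv
    rw [Projectivization.smul_mk, Projectivization.smul_mk, Projectivization.mk_eq_mk_iff']
    exact ⟨s, (hs v).symm⟩

theorem permPSL_le_permPGL : permPSL K ≤ permPGL K := by
  rintro _ ⟨g, rfl⟩
  exact ⟨(g : Matrix.GeneralLinearGroup (Fin 2) K), toPermHom_eq_of_eq_smul 1 fun v =>
    (one_smul K _).symm⟩

/-- The point at infinity of the projective line. -/
def infty (K : Type*) [Field K] : ℙ K (Fin 2 → K) :=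
  Projectivization.mk K ![1, 0] fun h => one_ne_zero (congrFun h 0)

theorem apply_one_zero_of_smul_infty {g : Matrix.GeneralLinearGroup (Fin 2) K}
    (h : g • infty K = infty K) : g.1 1 0 = 0 := by
  rw [infty, Projectivization.smul_mk, Projectivization.mk_eq_mk_iff'] at h
  obtain ⟨s, hs⟩ := h
  have := congrFun hs 1
  change _ = g.1.mulVec ![1, 0] 1 at this
  simpa [Matrix.mulVec, dotProduct, Fin.sum_univ_two] using this.symm

/-- A matrix acting trivially on the projective line is scalar. -/
theorem eq_scalar_of_toPermHom_eq_one {g : Matrix.GeneralLinearGroup (Fin 2) K}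
    (h : MulAction.toPermHom _ (ℙ K (Fin 2 → K)) g = 1) :
    g.1 1 0 = 0 ∧ g.1 0 1 = 0 ∧ g.1 0 0 = g.1 1 1 := by
  have key : ∀ v : Fin 2 → K, v ≠ 0 → ∃ s : K, s • v = g.1.mulVec v := fun v hv => by
    have h1 : g • Projectivization.mk K v hv = Projectivization.mk K v hv :=
      Equiv.ext_iff.1 h (Projectivization.mk K v hv)
    rw [Projectivization.smul_mk, Projectivization.mk_eq_mk_iff'] at h1
    exact h1
  obtain ⟨s, hs⟩ := key ![1, 0] fun h => one_ne_zero (congrFun h 0)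
  obtain ⟨t, ht⟩ := key ![0, 1] fun h => one_ne_zero (congrFun h 1)
  obtain ⟨u, hu⟩ := key ![1, 1] fun h => one_ne_zero (congrFun h 0)
  have h1 := congrFun hs 1
  have h2 := congrFun ht 0
  have h3 := congrFun hu 0
  have h4 := congrFun hu 1
  simp [Matrix.mulVec, dotProduct, Fin.sum_univ_two] at h1 h2 h3 h4
  exact ⟨h1.symm, h2.symm, by rw [← h1, zero_add] at h4; rw [← h2, add_zero] at h3; rw [← h3, h4]⟩

/-- The action determines a matrix up to a scalar, hence its determinant up to a square; conversely,
if the determinant is `s * s`, scaling by `s⁻¹` makes it `1`. -/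
theorem toPermHom_mem_permPSL_iff {g : Matrix.GeneralLinearGroup (Fin 2) K} :
    MulAction.toPermHom _ (ℙ K (Fin 2 → K)) g ∈ permPSL K ↔ IsSquare g.1.det := by
  constructor
  · rintro ⟨s, hs⟩
    have h1 : MulAction.toPermHom (Matrix.SpecialLinearGroup (Fin 2) K) (ℙ K (Fin 2 → K)) s =
        MulAction.toPermHom _ (ℙ K (Fin 2 → K)) (s : Matrix.GeneralLinearGroup (Fin 2) K) :=
      toPermHom_eq_of_eq_smul 1 fun v => (one_smul K _).symm
    have h2 : MulAction.toPermHom _ (ℙ K (Fin 2 → K))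
        ((s : Matrix.GeneralLinearGroup (Fin 2) K)⁻¹ * g) = 1 := by
      rw [map_mul, map_inv, ← h1, hs, inv_mul_cancel]
    obtain ⟨h10, h01, h00⟩ := eq_scalar_of_toPermHom_eq_one h2
    have h3 : g.1 = s.1 * ((s : Matrix.GeneralLinearGroup (Fin 2) K)⁻¹ * g).1 :=
      congrArg Units.val (mul_inv_cancel_left (s : Matrix.GeneralLinearGroup (Fin 2) K) g).symm
    rw [h3, Matrix.det_mul, s.2, one_mul, Matrix.det_fin_two, h10, h01, h00]
    exact ⟨_, sub_eq_self.2 (mul_zero _)⟩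
  · rintro ⟨s, hs⟩
    have hdet : g.1.det ≠ 0 := (Matrix.isUnit_iff_isUnit_det g.1).1 g.isUnit |>.ne_zero
    have hs0 : s ≠ 0 := by
      rintro rfl
      exact hdet (by rw [hs, mul_zero])
    refine ⟨⟨s⁻¹ • g.1, ?_⟩, toPermHom_eq_of_eq_smul s⁻¹ fun v => Matrix.smul_mulVec _ _ _⟩
    rw [Matrix.det_smul, hs, Fintype.card_fin]
    field_simp

theorem toPermHom_sq_mem_permPSL (g : Matrix.GeneralLinearGroup (Fin 2) K) :
    MulAction.toPermHom _ (ℙ K (Fin 2 → K)) g ^ 2 ∈ permPSL K := by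
  rw [← map_pow, toPermHom_mem_permPSL_iff]
  exact ⟨g.1.det, by rw [Units.val_pow_eq_pow_val, Matrix.det_pow, sq]⟩

/-- An element of odd order `p` is the square of its power `(p + 1) / 2`, hence in `PSL`. An upper
triangular matrix whose square is scalar has diagonal entries equal up to sign, so its determinant
is plus or minus a square, and `-1` is a square as `q ≡ 1` modulo `4`. -/
theorem isEssentialIn_stab_infty [Finite K] (hK : Nat.card K % 4 = 1) :
    IsEssentialIn (pointStab (permPSL K) (infty K)) (pointStab (permPGL K) (infty K)) := by
  refine isEssentialIn_of_prime (inf_le_inf_right _ permPSL_le_permPGL) fun x hx p hp hxp =>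
    ⟨?_, hx.2⟩
  obtain ⟨⟨g, rfl⟩, hgx⟩ := hx
  rcases hp.eq_two_or_odd' with rfl | ⟨m, rfl⟩
  · have hg10 : g.1 1 0 = 0 := apply_one_zero_of_smul_infty hgx
    rw [← map_pow] at hxp
    have h00 := (eq_scalar_of_toPermHom_eq_one hxp).2.2
    rw [Units.val_pow_eq_pow_val, sq] at h00
    simp only [Matrix.mul_apply, Fin.sum_univ_two, hg10, mul_zero, zero_mul, add_zero,
      zero_add] at h00
    refine toPermHom_mem_permPSL_iff.2 ?_
    rw [Matrix.det_fin_two, hg10, mul_zero, sub_zero]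
    rcases mul_self_eq_mul_self_iff.1 h00 with h | h
    · exact ⟨g.1 1 1, by rw [h]⟩
    · have : Fintype K := Fintype.ofFinite K
      obtain ⟨i, hi⟩ := FiniteField.isSquare_neg_one_iff.2
        (by rw [← Nat.card_eq_fintype_card, hK]; decide : Fintype.card K % 4 ≠ 3)
      exact ⟨i * g.1 1 1, by linear_combination g.1 1 1 * h + g.1 1 1 * g.1 1 1 * hi⟩
  · have h1 := toPermHom_sq_mem_permPSL (g ^ (m + 1))
    rwa [map_pow, ← pow_mul, show (m + 1) * 2 = 2 * m + 1 + 1 by ring, pow_succ, hxp,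
      one_mul] at h1

/-- An upper triangular matrix can be scaled so that its lower right entry is `1`, leaving two free
entries. The crude bound `q * q` is enough for the application. -/
theorem card_stab_infty_le [Finite K] :
    Nat.card (pointStab (permPGL K) (infty K)) ≤ Nat.card K * Nat.card K := by
  choose g hg using fun x : pointStab (permPGL K) (infty K) => x.2.1
  have h10 : ∀ x, (g x).1 1 0 = 0 := fun x => by
    refine apply_one_zero_of_smul_infty ?_
    have h1 : (x : Equiv.Perm _) (infty K) = infty K := x.2.2
    rw [← hg x] at h1
    exact h1
  have h11 : ∀ x, (g x).1 1 1 ≠ 0 := fun x h => by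
    have hdet : (g x).1.det ≠ 0 :=
      (Matrix.isUnit_iff_isUnit_det (g x).1).1 (g x).isUnit |>.ne_zero
    rw [Matrix.det_fin_two, h10, h] at hdet
    simp at hdet
  rw [← Nat.card_prod]
  refine Nat.card_le_card_of_injective
    (fun x => ((g x).1 0 0 / (g x).1 1 1, (g x).1 0 1 / (g x).1 1 1)) fun x y hxy => ?_
  have h1 := congrArg Prod.fst hxy
  have h2 := congrArg Prod.snd hxy
  simp only at h1 h2
  rw [div_eq_div_iff (h11 x) (h11 y)] at h1 h2
  have hmat : (g x).1 = ((g x).1 1 1 / (g y).1 1 1) • (g y).1 := by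
    have hy := h11 y
    ext i j
    rw [Matrix.smul_apply, smul_eq_mul, div_mul_eq_mul_div, eq_div_iff hy]
    fin_cases i <;> fin_cases j
    · simp only [Fin.zero_eta]; rw [h1, mul_comm]
    · simp only [Fin.zero_eta, Fin.mk_one]; rw [h2, mul_comm]
    · simp [h10]
    · rfl
  refine Subtype.ext ?_
  rw [← hg x, ← hg y]
  refine toPermHom_eq_of_eq_smul ((g x).1 1 1 / (g y).1 1 1) fun v => ?_
  change (g x).1.mulVec v = _ • (g y).1.mulVec v
  rw [← Matrix.smul_mulVec, ← hmat]

/-- The diagonal matrix with entries `ν` and `1`, for a non-square `ν`, fixes infinity and is not in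
`PSL`. -/
theorem two_le_relIndex_stab_infty [Finite K] (hK : Nat.card K % 4 = 1) :
    2 ≤ (pointStab (permPSL K) (infty K)).relIndex (pointStab (permPGL K) (infty K)) := by
  have h0 : (pointStab (permPSL K) (infty K)).relIndex (pointStab (permPGL K) (infty K)) ≠ 0 :=
    Subgroup.index_ne_zero_of_finite
  have h1 : (pointStab (permPSL K) (infty K)).relIndex (pointStab (permPGL K) (infty K)) ≠ 1 := by
    rw [Ne, Subgroup.relIndex_eq_one]
    intro hle
    have : Fintype K := Fintype.ofFinite K
    have hchar : ringChar K ≠ 2 := fun h => by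
      have := FiniteField.even_card_iff_char_two.1 h
      rw [← Nat.card_eq_fintype_card] at this
      omega
    obtain ⟨ν, hν⟩ := FiniteField.exists_nonsquare hchar
    have hν0 : ν ≠ 0 := by
      rintro rfl
      exact hν (IsSquare.zero)
    have hdet : (Matrix.of ![![ν, 0], ![0, 1]]).det = ν := by simp [Matrix.det_fin_two]
    let g : Matrix.GeneralLinearGroup (Fin 2) K :=
      Matrix.GeneralLinearGroup.mkOfDetNeZero (Matrix.of ![![ν, 0], ![0, 1]]) (by rwa [hdet])
    have hg : MulAction.toPermHom _ (ℙ K (Fin 2 → K)) g ∈ pointStab (permPGL K) (infty K) := by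
      refine ⟨⟨g, rfl⟩, ?_⟩
      change g • infty K = infty K
      rw [infty, Projectivization.smul_mk, Projectivization.mk_eq_mk_iff']
      refine ⟨ν, ?_⟩
      change _ = (Matrix.of ![![ν, 0], ![0, 1]]).mulVec ![1, 0]
      ext i
      fin_cases i <;> simp [Matrix.mulVec, dotProduct, Fin.sum_univ_two]
    have h2 := toPermHom_mem_permPSL_iff.1 (hle hg).1
    exact hν (hdet ▸ h2)
  omega

theorem sq_lt_two_pow {q : ℕ} (hq : 5 ≤ q) : q * q < 2 ^ q := by
  induction q, hq using Nat.le_induction with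
  | base => norm_num
  | succ n hn ih =>
    rw [pow_succ]
    nlinarith

theorem not_hasLattice_groupG_projectiveLine [Finite K] (hK : Nat.card K % 4 = 1) {V : Type*}
    {T : SimpleGraph V} (hT : T.IsTree) (c : LegalColoring T (ℙ K (Fin 2 → K))) :
    ¬ HasLattice (c.GroupG (permPSL K) (permPGL K)) := by
  have hcard : Nat.card (ℙ K (Fin 2 → K)) = Nat.card K + 1 :=
    Projectivization.card_of_finrank_two K _ (Module.finrank_fin_fun K)
  have hq : 5 ≤ Nat.card K := by
    have := Finite.one_lt_card (α := K)
    omega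
  refine c.not_hasLattice_groupG (by omega) hT permPSL_le_permPGL (permPSL_isPretransitive K)
    (infty K) le_rfl (isEssentialIn_stab_infty hK) ?_
  rw [hcard, Nat.add_sub_cancel]
  exact (card_stab_infty_le.trans_lt (sq_lt_two_pow hq)).trans_le
    (Nat.pow_le_pow_left (two_le_relIndex_stab_infty hK) _)

end ProjectiveLine

/-! ### A concrete regular tree with a legal colouring. -/

section ReducedWords

universe u

/-- The words without two equal consecutive letters. -/
abbrev ReducedWord (Ω : Type u) : Type u := {l : List Ω // l.IsChain (· ≠ ·)}

variable {Ω : Type u}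

/-- The regular tree of reduced words: two words are adjacent if one of them is obtained
by adding a letter in front of the other. -/
def wordTree (Ω : Type u) : SimpleGraph (ReducedWord Ω) where
  Adj v w := ∃ a, w.1 = a :: v.1 ∨ v.1 = a :: w.1
  symm := ⟨fun _ _ ⟨a, h⟩ => ⟨a, h.symm⟩⟩
  loopless := ⟨fun v ⟨a, h⟩ => by
    rcases h with h | h <;> exact absurd (congrArg List.length h) (by simp)⟩

theorem wordTree_connected : (wordTree Ω).Connected := by
  have key : ∀ (l : List Ω) (hl : l.IsChain (· ≠ ·)),
      (wordTree Ω).Reachable ⟨[], List.isChain_nil⟩ ⟨l, hl⟩ := by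
    intro l
    induction l with
    | nil => exact fun _ => SimpleGraph.Reachable.refl _
    | cons a l ih =>
      exact fun hl => (ih hl.tail).trans (SimpleGraph.Adj.reachable ⟨a, Or.inl rfl⟩)
  have : Nonempty (ReducedWord Ω) := ⟨⟨[], List.isChain_nil⟩⟩
  exact ⟨fun v w => (key v.1 v.2).symm.trans (key w.1 w.2)⟩

theorem wordTree_isAcyclic : (wordTree Ω).IsAcyclic := by
  rw [SimpleGraph.isAcyclic_iff_forall_adj_isBridge]
  have key : ∀ (v w : ReducedWord Ω) (a : Ω), w.1 = a :: v.1 →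
      (wordTree Ω).IsBridge s(v, w) := by
    intro v w a hw
    rw [SimpleGraph.isBridge_iff]
    rintro ⟨p⟩
    -- Letters are added in front, so the words with suffix `w` form the branch above `w`; the
    -- deleted edge is the only one by which this branch can be left.
    have hinv : ∀ {x y : ReducedWord Ω} (_ : ((wordTree Ω).deleteEdges {s(v, w)}).Walk x y),
        (w.1 <:+ x.1 ↔ w.1 <:+ y.1) := by
      have hstep : ∀ {x y : ReducedWord Ω} (b : Ω), y.1 = b :: x.1 → s(x, y) ≠ s(v, w) →
          (w.1 <:+ x.1 ↔ w.1 <:+ y.1) := by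
        intro x y b hy hne
        rw [hy, List.suffix_cons_iff]
        refine ⟨Or.inr, fun h => h.resolve_left fun h' => hne ?_⟩
        have h1 : w = y := Subtype.ext (h'.trans hy.symm)
        have h2 : v = x := Subtype.ext (List.cons_eq_cons.1 (hw.symm.trans h')).2
        rw [h1, h2]
      intro x y p
      induction p with
      | nil => rfl
      | cons h _ ih =>
        rw [SimpleGraph.deleteEdges_adj] at h
        obtain ⟨⟨b, hb | hb⟩, hne⟩ := h
        · exact (hstep b hb hne).trans ih
        · exact (hstep b hb (fun h' => hne (Sym2.eq_swap.trans h'))).symm.trans ih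
    have h1 := ((hinv p).2 (List.suffix_refl _)).length_le
    rw [hw, List.length_cons] at h1
    omega
  rintro v w ⟨a, h | h⟩
  · exact key v w a h
  · rw [Sym2.eq_swap]
    exact key w v a h

theorem wordTree_isTree : (wordTree Ω).IsTree := ⟨wordTree_connected, wordTree_isAcyclic⟩

theorem exists_color (e : (wordTree Ω).edgeSet) :
    ∃ a, ∃ v w : ReducedWord Ω, e.1 = s(v, w) ∧ w.1 = a :: v.1 := by
  obtain ⟨e, he⟩ := e
  induction e using Sym2.ind with
  | _ v w =>
    obtain ⟨a, h | h⟩ := he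
    · exact ⟨a, v, w, rfl, h⟩
    · exact ⟨a, w, v, Sym2.eq_swap, h⟩

/-- The lengths of the two ends tell which is the longer word, so the added letter does not depend
on the choice. -/
theorem choose_exists_color {v w : ReducedWord Ω} {a : Ω} (h : (wordTree Ω).Adj v w)
    (ha : w.1 = a :: v.1 ∨ v.1 = a :: w.1) : (exists_color ⟨s(v, w), h⟩).choose = a := by
  obtain ⟨v', w', he, hw⟩ := (exists_color ⟨s(v, w), h⟩).choose_spec
  generalize (exists_color ⟨s(v, w), h⟩).choose = b at hw ⊢
  rcases Sym2.eq_iff.1 he with ⟨rfl, rfl⟩ | ⟨rfl, rfl⟩ <;> rcases ha with ha | ha <;>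
    rw [ha] at hw
  · exact (List.cons_eq_cons.1 hw).1.symm
  · exact absurd (congrArg List.length hw) (by simp only [List.length_cons]; omega)
  · exact absurd (congrArg List.length hw) (by simp only [List.length_cons]; omega)
  · exact (List.cons_eq_cons.1 hw).1.symm

/-- The legal colouring of the tree of reduced words by the added letters. -/
noncomputable def wordColoring (Ω : Type u) : LegalColoring (wordTree Ω) Ω where
  color e := (exists_color e).choose
  bijective v := by
    constructor
    · rintro ⟨w, a, hw⟩ ⟨w', b, hw'⟩ h
      have hab : a = b := by
        rw [← choose_exists_color ⟨a, hw⟩ hw, ← choose_exists_color ⟨b, hw'⟩ hw']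
        exact h
      subst hab
      refine Subtype.ext (Subtype.ext ?_)
      have key : ∀ x y : ReducedWord Ω, x.1 = a :: v.1 → v.1 = a :: y.1 → False := by
        intro x y hx hy
        have := x.2
        rw [hx, hy] at this
        simp at this
      rcases hw with hw | hw <;> rcases hw' with hw' | hw'
      · rw [hw, hw']
      · exact (key _ _ hw hw').elim
      · exact (key _ _ hw' hw).elim
      · exact (List.cons_eq_cons.1 (hw.symm.trans hw')).2
    · intro a
      have key : ∃ w : ReducedWord Ω, w.1 = a :: v.1 ∨ v.1 = a :: w.1 := by
        obtain ⟨l, hl⟩ := v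
        cases l with
        | nil => exact ⟨⟨[a], List.isChain_singleton a⟩, Or.inl rfl⟩
        | cons b l =>
          by_cases hab : a = b
          · exact ⟨⟨l, hl.tail⟩, Or.inr (by rw [hab])⟩
          · exact ⟨⟨a :: b :: l, List.isChain_cons_cons.2 ⟨hab, hl⟩⟩, Or.inl rfl⟩
      obtain ⟨w, hw⟩ := key
      exact ⟨⟨w, a, hw⟩, choose_exists_color ⟨a, hw⟩ hw⟩

end ReducedWords

/-! ### A small example: affine groups modulo `5`. -/

section Affine

variable {R : Type*} [CommRing R]

/-- The group of affine permutations `x ↦ u x + b` of `R` with `u` in the group `H`. -/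
def affinePerm (H : Subgroup Rˣ) : Subgroup (Equiv.Perm R) where
  carrier := {σ | ∃ u ∈ H, ∃ b : R, ∀ x, σ x = u * x + b}
  one_mem' := ⟨1, H.one_mem, 0, fun x => by simp⟩
  mul_mem' := by
    rintro σ τ ⟨u, hu, b, hσ⟩ ⟨v, hv, b', hτ⟩
    refine ⟨u * v, H.mul_mem hu hv, u * b' + b, fun x => ?_⟩
    rw [Equiv.Perm.mul_apply, hτ, hσ, Units.val_mul]
    ring
  inv_mem' := by
    rintro σ ⟨u, hu, b, hσ⟩
    refine ⟨u⁻¹, H.inv_mem hu, -((u⁻¹ : Rˣ) : R) * b, fun x => ?_⟩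
    rw [Equiv.Perm.inv_eq_iff_eq, hσ]
    linear_combination (b - x) * u.mul_inv

theorem affinePerm_mono {H H' : Subgroup Rˣ} (h : H ≤ H') : affinePerm H ≤ affinePerm H' :=
  fun _ ⟨u, hu, b, hσ⟩ => ⟨u, h hu, b, hσ⟩

theorem affinePerm_isPretransitive (H : Subgroup Rˣ) :
    MulAction.IsPretransitive (affinePerm H) R :=
  ⟨fun x y => ⟨⟨Equiv.addRight (y - x), 1, H.one_mem, y - x, fun z => by simp⟩,
    add_sub_cancel x y⟩⟩

theorem exists_eq_mul_of_mem_pointStab {H : Subgroup Rˣ} {σ : Equiv.Perm R}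
    (h : σ ∈ pointStab (affinePerm H) 0) : ∃ u ∈ H, ∀ x, σ x = u * x := by
  obtain ⟨⟨u, hu, b, hσ⟩, h0⟩ := h
  have h1 : σ 0 = 0 := h0
  rw [hσ, mul_zero, zero_add] at h1
  exact ⟨u, hu, fun x => by rw [hσ, h1, add_zero]⟩

theorem mem_pointStab_of_eq_mul {H : Subgroup Rˣ} {σ : Equiv.Perm R} {u : Rˣ} (hu : u ∈ H)
    (h : ∀ x, σ x = u * x) : σ ∈ pointStab (affinePerm H) 0 :=
  ⟨⟨u, hu, 0, fun x => by rw [h, add_zero]⟩, (h 0).trans (mul_zero _)⟩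

/-- The stabilizer of `0` consists of multiplications by units. Those of order `2` have multiplier
of square `1`; those of odd order are squares, and `u ^ 2` has square `u ^ 4 = 1`. -/
theorem isEssentialIn_pointStab_affinePerm [Finite R] (h4 : ∀ u : Rˣ, u ^ 4 = 1) :
    IsEssentialIn (pointStab (affinePerm (powMonoidHom 2 : Rˣ →* Rˣ).ker) 0)
      (pointStab (affinePerm (⊤ : Subgroup Rˣ)) 0) := by
  refine isEssentialIn_of_prime (inf_le_inf_right _ (affinePerm_mono le_top))
    fun σ hσ p hp hpσ => ?_
  rcases hp.eq_two_or_odd' with rfl | ⟨m, rfl⟩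
  · obtain ⟨u, -, hu⟩ := exists_eq_mul_of_mem_pointStab hσ
    refine mem_pointStab_of_eq_mul (u := u) ?_ hu
    refine MonoidHom.mem_ker.2 (Units.ext ?_)
    have h1 := Equiv.ext_iff.1 hpσ 1
    rw [sq, Equiv.Perm.mul_apply, hu, hu, mul_one] at h1
    simpa [sq] using h1
  · obtain ⟨u, -, hu⟩ := exists_eq_mul_of_mem_pointStab (Subgroup.pow_mem _ hσ (m + 1))
    refine mem_pointStab_of_eq_mul (u := u ^ 2) (MonoidHom.mem_ker.2 ?_) fun x => ?_
    · rw [powMonoidHom_apply, ← pow_mul]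
      exact h4 u
    · have h1 : σ = σ ^ (m + 1) * σ ^ (m + 1) := by
        rw [← pow_add, show m + 1 + (m + 1) = 2 * m + 1 + 1 by ring, pow_succ, hpσ, one_mul]
      rw [h1, Equiv.Perm.mul_apply, hu, hu, Units.val_pow_eq_pow_val]
      ring

theorem card_pointStab_affinePerm_le [Finite R] (H : Subgroup Rˣ) :
    Nat.card (pointStab (affinePerm H) 0) ≤ Nat.card Rˣ := by
  choose u hu huσ using fun σ : pointStab (affinePerm H) 0 => exists_eq_mul_of_mem_pointStab σ.2
  refine Nat.card_le_card_of_injective u fun σ τ h => Subtype.ext (Equiv.ext fun x => ?_)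
  rw [huσ, huσ, h]

theorem two_le_relIndex_pointStab_affinePerm [Finite R] {u : Rˣ} (hu : u ^ 2 ≠ 1) :
    2 ≤ (pointStab (affinePerm (powMonoidHom 2 : Rˣ →* Rˣ).ker) 0).relIndex
      (pointStab (affinePerm (⊤ : Subgroup Rˣ)) 0) := by
  set D := pointStab (affinePerm (powMonoidHom 2 : Rˣ →* Rˣ).ker) 0
  set D' := pointStab (affinePerm (⊤ : Subgroup Rˣ)) 0
  have h0 : D.relIndex D' ≠ 0 := Subgroup.index_ne_zero_of_finite
  have h1 : D.relIndex D' ≠ 1 := by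
    rw [Ne, Subgroup.relIndex_eq_one]
    intro hle
    have hmem : u.mulLeft ∈ D' := mem_pointStab_of_eq_mul (Subgroup.mem_top u) fun _ => rfl
    obtain ⟨v, hv, huv⟩ := exists_eq_mul_of_mem_pointStab (hle hmem)
    have h2 : u = v := Units.ext (by simpa using huv 1)
    exact hu (by simpa [h2] using hv)
  omega

theorem not_hasLattice_groupG_affinePerm {V : Type*} {T : SimpleGraph V} (hT : T.IsTree)
    (c : LegalColoring T (ZMod 5)) :
    ¬ HasLattice (c.GroupG (affinePerm (powMonoidHom 2 : (ZMod 5)ˣ →* (ZMod 5)ˣ).ker)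
      (affinePerm ⊤)) := by
  have hcard : Nat.card (ZMod 5)ˣ = 4 := by
    rw [Nat.card_eq_fintype_card, ZMod.card_units_eq_totient]
    decide
  refine c.not_hasLattice_groupG (by simp) hT (affinePerm_mono le_top)
    (affinePerm_isPretransitive _) 0 le_rfl
    (isEssentialIn_pointStab_affinePerm fun u => by rw [← hcard, pow_card_eq_one']) ?_
  -- The unit `2`, with inverse `3`, has order `4` modulo `5`. The required inequality becomes `4 <
  -- 2 ^ 4`.
  have h2 := two_le_relIndex_pointStab_affinePerm
    (u := (⟨2, 3, by decide, by decide⟩ : (ZMod 5)ˣ)) (by decide)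
  calc Nat.card (pointStab (affinePerm (⊤ : Subgroup (ZMod 5)ˣ)) 0)
      ≤ 4 := hcard ▸ card_pointStab_affinePerm_le _
    _ < 2 ^ 4 := by norm_num
    _ ≤ _ := by
      rw [Nat.card_zmod]
      exact Nat.pow_le_pow_left h2 _

end Affine

end TreeLattice

open TreeLattice in
theorem mainTheorem4 :
    -- powers of `L(D, D')`
    (∀ (X : Type*) [Finite X] [Nonempty X] (_ : 2 ≤ Nat.card X)
      (D D' : Subgroup (Equiv.Perm X)) (h : D ≤ D'),
      IsEssentialIn D D' → Nat.card D' < D.relIndex D' ^ Nat.card X →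
        ∀ k : ℕ, 1 ≤ k → ¬ HasLattice (Fin k → GroupL h)) ∧
    -- the groups `G(F, F')`
    (∀ (V : Type*) (Ω : Type*) [Finite Ω] (_ : 3 ≤ Nat.card Ω)
      (T : SimpleGraph V) (_ : T.IsTree) (c : LegalColoring T Ω)
      (F F' : Subgroup (Equiv.Perm Ω)), F ≤ F' → MulAction.IsPretransitive F Ω →
      ∀ (a : Ω) (D' : Subgroup (Equiv.Perm Ω)),
        pointStab F a ≤ D' →
        D' ≤ pointStab F' a →
        IsEssentialIn (pointStab F a) D' →
        Nat.card D' < (pointStab F a).relIndex D' ^ (Nat.card Ω - 1) →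
        ¬ HasLattice (c.GroupG F F')) ∧
    -- `F = PSL(2, q)` and `F' = PGL(2, q)` acting on the projective line
    (∀ (V : Type*) (K : Type*) [Field K] [Finite K] (_ : Nat.card K % 4 = 1)
      (T : SimpleGraph V) (_ : T.IsTree) (c : LegalColoring T (ℙ K (Fin 2 → K))),
      ¬ HasLattice (c.GroupG
        (MulAction.toPermHom (Matrix.SpecialLinearGroup (Fin 2) K) (ℙ K (Fin 2 → K))).range
        (MulAction.toPermHom (Matrix.GeneralLinearGroup (Fin 2) K) (ℙ K (Fin 2 → K))).range)) ∧
    -- existence of permutation groups `F ≤ F' ≤ F̂` for which `G(F, F')` has no lattice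
    (∃ (d : ℕ) (_ : 3 ≤ d) (F F' : Subgroup (Equiv.Perm (Fin d)))
      (V : Type) (T : SimpleGraph V) (_ : T.IsTree) (c : LegalColoring T (Fin d)),
      F ≤ F' ∧ (∀ σ ∈ F', ∀ x, σ x ∈ MulAction.orbit F x) ∧ ¬ HasLattice (c.GroupG F F')) := by
  refine ⟨fun X _ _ hX D D' h hD hcard k hk => not_hasLattice_pi_groupL h hX hD hcard hk,
    fun V Ω _ hΩ T hT c F F' hFF' hF a D' _ hD' hess hcard =>
      c.not_hasLattice_groupG hΩ hT hFF' hF a hD' hess hcard,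
    fun V K _ _ hK T hT c => not_hasLattice_groupG_projectiveLine hK hT c,
    5, by norm_num, affinePerm (R := ZMod 5) (powMonoidHom 2 : (ZMod 5)ˣ →* (ZMod 5)ˣ).ker,
    affinePerm (R := ZMod 5) ⊤, ReducedWord (Fin 5), wordTree (Fin 5), wordTree_isTree,
    wordColoring (Fin 5), affinePerm_mono le_top, fun σ _ x => ?_,
    not_hasLattice_groupG_affinePerm wordTree_isTree (wordColoring (Fin 5))⟩
  -- The smaller group contains the translations, so it has a single orbit, which any permutation
  -- preserves. `ZMod 5` unfolds to `Fin 5`.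
  have h := affinePerm_isPretransitive (R := ZMod 5) (powMonoidHom 2 : (ZMod 5)ˣ →* (ZMod 5)ˣ).ker
  exact h.exists_smul_eq x (σ x)
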